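/- Let $a,b,c>0$ and let $$g(x)=\begin{cases}-a, & |x|>c,\\ b, & |x|<c.\end{cases}$$ Let $\gamma<0$ and let $\omega$ be a real number such that $\sqrt b\,\omega c\,\frac{2}{\pi}=\frac{p}{q}$ for some odd positive integers $p,q$ (in particular $\omega>0$). Put $T=\frac{2\pi}{\omega}$, let $\mathbb T_T=\mathbb R/T\mathbb Z$, and let $D=\mathbb R\times\mathbb T_T$. A function $w\in H^1(D)$, $w=w(x,t)$, whose trace $w(0,\cdot)$ on the line $x=0$ has a weak derivative $\partial_t w(0,\cdot)\in L^3(\mathbb T_T)$, is called a $T$-periodic weak solution of $$g(x)\,w_{tt}-w_{xx}+\gamma\,\delta_0(x)\,(w_t^3)_t=0 \qquad (x,t)\in\mathbb R\times\mathbb R \qquad (*)$$ if for every $\psi\in C_c^\infty(\mathbb R\times\mathbb T_T)$ $$\int_D \bigl(-g(x)\,\partial_t w\,\partial_t\psi+\partial_x w\,\partial_x\psi\bigr)\,d(x,t)-\gamma\int_0^T(\partial_t w(0,t))^3\,\partial_t\psi(0,t)\,dt=0 .$$ Then there exist infinitely many nontrivial, real-valued, $T$-periodic weak solutions of $(*)$,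 no two of which agree (almost everywhere) up to a translation in time, and each of which is exponentially localized in space: for each of these solutions $w$ there are constants $C,\rho>0$ such that $|w(x,t)|\le C e^{-\rho|x|}$ for all $(x,t)\in\mathbb R^2$. -/

import Mathlib

open MeasureTheory

noncomputable section

namespace Breather

/-- The step potential: `b` for `|x| < c` and `-a` for `|x| > c`
(the value on the null set `|x| = c` plays no role). -/
def stepPotential (a b c : ℝ) (x : ℝ) : ℝ := if |x| < c then b else -a

/-- Lebesgue measure on `D = ℝ × 𝕋_T`. Functions on the cylinder `ℝ × 𝕋_T` are represented by
functions of `(x, t) ∈ ℝ × ℝ` that are `T`-periodic in `t`, and `ℝ × (0, T]` is a fundamental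
domain. -/
def cylMeasure (T : ℝ) : Measure (ℝ × ℝ) :=
  volume.restrict (Set.univ ×ˢ Set.Ioc 0 T)

/-- Lebesgue measure on the half cylinder `(0, ∞) × 𝕋_T`. -/
def halfCylMeasure (T : ℝ) : Measure (ℝ × ℝ) :=
  volume.restrict (Set.Ioi 0 ×ˢ Set.Ioc 0 T)

/-- Lebesgue measure on the torus `𝕋_T`, with fundamental domain `(0, T]`. -/
def torusMeasure (T : ℝ) : Measure ℝ := volume.restrict (Set.Ioc 0 T)

/-- Periodicity with period `T` in the time variable. -/
def TimePeriodic (T : ℝ) (w : ℝ × ℝ → ℝ) : Prop :=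
  ∀ x t : ℝ, w (x, t + T) = w (x, t)

/-- Classical partial derivative in `x`. -/
def dx (ψ : ℝ × ℝ → ℝ) (p : ℝ × ℝ) : ℝ := deriv (fun y => ψ (y, p.2)) p.1

/-- Classical partial derivative in `t`. -/
def dt (ψ : ℝ × ℝ → ℝ) (p : ℝ × ℝ) : ℝ := deriv (fun s => ψ (p.1, s)) p.2

/-- Test functions `ψ ∈ C_c^∞(ℝ × 𝕋_T)`: smooth, `T`-periodic in `t`, and vanishing for large
`|x|` (which is compactness of the support on the cylinder). -/
structure IsTest (T : ℝ) (ψ : ℝ × ℝ → ℝ) : Prop where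
  smooth : ContDiff ℝ ((⊤ : ℕ∞) : WithTop ℕ∞) ψ
  periodic : TimePeriodic T ψ
  support : ∃ R : ℝ, ∀ x t : ℝ, R < |x| → ψ (x, t) = 0

/-- `u ∈ L²(ℝ × 𝕋_T)` is the weak derivative `∂_x w` on `ℝ × 𝕋_T`. -/
def IsWeakDx (T : ℝ) (w u : ℝ × ℝ → ℝ) : Prop :=
  MemLp u 2 (cylMeasure T) ∧
    ∀ ψ, IsTest T ψ →
      ∫ p, w p * dx ψ p ∂(cylMeasure T) = -∫ p, u p * ψ p ∂(cylMeasure T)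

/-- `u ∈ L²(ℝ × 𝕋_T)` is the weak derivative `∂_t w` on `ℝ × 𝕋_T`. -/
def IsWeakDt (T : ℝ) (w u : ℝ × ℝ → ℝ) : Prop :=
  MemLp u 2 (cylMeasure T) ∧
    ∀ ψ, IsTest T ψ →
      ∫ p, w p * dt ψ p ∂(cylMeasure T) = -∫ p, u p * ψ p ∂(cylMeasure T)

/-- `v ∈ L²(𝕋_T)` is the trace `w(0, ·)` of `w ∈ H¹(ℝ × 𝕋_T)` on the line `x = 0`; here `wx` is
the weak derivative `∂_x w`, and the trace is characterized by integration by parts on the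
half cylinder `x > 0`. -/
def IsTraceAtZero (T : ℝ) (w wx : ℝ × ℝ → ℝ) (v : ℝ → ℝ) : Prop :=
  MemLp v 2 (torusMeasure T) ∧
    ∀ ψ, IsTest T ψ →
      ∫ p, (w p * dx ψ p + wx p * ψ p) ∂(halfCylMeasure T)
        = -∫ t, v t * ψ (0, t) ∂(torusMeasure T)

/-- `z ∈ L³(𝕋_T)` is the weak derivative on the torus `𝕋_T` of the function `v`. -/
def IsWeakDerivTorusL3 (T : ℝ) (v z : ℝ → ℝ) : Prop :=
  MemLp z 3 (torusMeasure T) ∧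
    ∀ η : ℝ → ℝ, ContDiff ℝ ((⊤ : ℕ∞) : WithTop ℕ∞) η → (∀ t, η (t + T) = η t) →
      ∫ t, v t * deriv η t ∂(torusMeasure T) = -∫ t, z t * η t ∂(torusMeasure T)

/-- `w` is a real-valued, `T`-periodic weak solution of
`g(x) w_tt - w_xx + γ δ₀(x) (w_t³)_t = 0`, where `g ∈ L^∞(ℝ)`: `w ∈ H¹(ℝ × 𝕋_T)` with weak
derivatives `wx`, `wt`, the trace `v = w(0, ·)` has weak derivative `z = ∂_t w(0, ·) ∈ L³(𝕋_T)`,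
and the weak equation holds for all test functions. The functions `wx, wt` (on `ℝ × (0, T]`) and
`v, z` (on `(0, T]`) are determined by `w` up to null sets. -/
def IsWeakSolution (T : ℝ) (g : ℝ → ℝ) (γ : ℝ) (w : ℝ × ℝ → ℝ) : Prop :=
  TimePeriodic T w ∧ MemLp w 2 (cylMeasure T) ∧
    ∃ (wx wt : ℝ × ℝ → ℝ) (v z : ℝ → ℝ),
      IsWeakDx T w wx ∧ IsWeakDt T w wt ∧
      IsTraceAtZero T w wx v ∧ IsWeakDerivTorusL3 T v z ∧
      ∀ ψ, IsTest T ψ →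
        ∫ p, (-g p.1 * wt p * dt ψ p + wx p * dx ψ p) ∂(cylMeasure T)
          - γ * ∫ t, (z t) ^ 3 * dt ψ (0, t) ∂(torusMeasure T) = 0

end Breather

end

/-! The resonance condition makes the linear part of the problem exactly solvable. If `cos (√b μ c)
= 0`, the decaying solution on the half line with value 1 at the origin has slope `b μ / √a` there
(`halfProfD_zero`), linear in `μ`. For a superposition `w = ∑ α_n P_n(x) cos (μ_n t)` of such modes,
reflected evenly in `x`, the jump of `∂_x w` at `x = 0` is therefore `2 b / √a` times `|D|` applied
to the trace, and the partial differential equation reduces to an equation on the circle for `z =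
∂_t w(0, ·)`. Taking frequencies `(2n+1) Ω` and `z = l U(Ω t)`, with `l` absorbing the constants
(possible because `γ < 0`), this equation becomes `|D| U³ = U`.

That equation is solved by monotone iteration (`exists_profile`). On odd, `π`-antiperiodic
functions, `|D|⁻¹` has kernel `log |(sin t + sin s) / (sin t - sin s)| / 2π` over `[0, π]`
(`integral_green_mul_sin`), which is nonnegative there (`green_nonneg`). The map `u ↦ (|D|⁻¹
u)^(1/3)` is thus monotone and sublinear, and `sin` is a subsolution, so the iterates increase to a
bounded nonzero fixed point.

Boundedness of `U` makes `α_n μ_n` square summable, hence `α_n` absolutely summable. The first gives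
the weak derivatives in `L²` by orthogonality in time (`exists_superposition`), the second the
pointwise exponential bound (`abs_modeSeries_le`). All weak identities are checked mode by mode and
summed.

An odd multiple of a resonant frequency is resonant, so infinitely many fundamental frequencies `Ω`
are available for the same `T`. Solutions with different `Ω` have different lowest frequencies,
which no time translation can change (`not_ae_eq`). -/

noncomputable section
namespace Breather
open Real Set Filter Topology intervalIntegral

/-! ### The kernel `log |tan (x / 2)|` -/

/-- The `2π`-periodic function `log |tan (x / 2)|`. -/
def logTan (x : ℝ) : ℝ := log (tan (x / 2))

lemma logTan_eq (x : ℝ) : logTan x = log (sin (x / 2) / cos (x / 2)) := by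
  rw [logTan, tan_eq_sin_div_cos]

/-- `Real.log` ignores the sign of its argument, so no absolute value is needed in the definition.
-/
lemma logTan_neg (x : ℝ) : logTan (-x) = logTan x := by
  rw [logTan, logTan, neg_div, tan_neg, log_neg_eq_log]

lemma logTan_periodic : Function.Periodic logTan (2 * π) := fun x => by
  rw [logTan, logTan, show (x + 2 * π) / 2 = x / 2 + π by ring, tan_add_pi]

lemma ae_sin_half_ne_zero : ∀ᵐ x : ℝ, sin (x / 2) ≠ 0 := by
  have h : {x : ℝ | sin (x / 2) = 0}.Countable := by
    refine (countable_range (fun n : ℤ => 2 * (n * π))).mono fun x hx => ?_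
    obtain ⟨n, hn⟩ := sin_eq_zero_iff.1 hx
    exact ⟨n, by simp only; linarith⟩
  simpa using h.ae_notMem volume

lemma ae_cos_half_ne_zero : ∀ᵐ x : ℝ, cos (x / 2) ≠ 0 := by
  have h : {x : ℝ | cos (x / 2) = 0}.Countable := by
    refine (countable_range (fun n : ℤ => (2 * n + 1) * π)).mono fun x hx => ?_
    obtain ⟨n, hn⟩ := cos_eq_zero_iff.1 hx
    exact ⟨n, by simp only; linarith⟩
  simpa using h.ae_notMem volume

lemma intervalIntegrable_logTan (a b : ℝ) : IntervalIntegrable logTan volume a b := by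
  have h1 : IntervalIntegrable (fun x => log (sin (x / 2))) volume a b := by
    have := (intervalIntegrable_log_sin (a := a / 2) (b := b / 2)).comp_mul_left (c := (1 / 2 : ℝ))
    simpa [div_eq_inv_mul] using this
  have h2 : IntervalIntegrable (fun x => log (cos (x / 2))) volume a b := by
    have := (intervalIntegrable_log_cos (a := a / 2) (b := b / 2)).comp_mul_left (c := (1 / 2 : ℝ))
    simpa [div_eq_inv_mul] using this
  refine (h1.sub h2).congr_ae (ae_restrict_of_ae ?_)
  filter_upwards [ae_sin_half_ne_zero, ae_cos_half_ne_zero] with x hs hc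
  rw [logTan_eq, log_div hs hc]

/-- The quotient `sin ((2 n + 1) x) / sin x`. -/
def sinQuot (n : ℕ) (x : ℝ) : ℝ := 1 + 2 * ∑ j ∈ Finset.range n, cos (2 * (j + 1) * x)

lemma continuous_sinQuot (n : ℕ) : Continuous (sinQuot n) := by unfold sinQuot; fun_prop

/-- Telescoping: `2 cos A sin x = sin (A + x) - sin (A - x)` with `A = 2 (n + 1) x`. -/
lemma sinQuot_mul_sin (n : ℕ) (x : ℝ) : sinQuot n x * sin x = sin ((2 * n + 1) * x) := by
  induction n with
  | zero => simp [sinQuot]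
  | succ n ih =>
    have h : sinQuot (n + 1) x = sinQuot n x + 2 * cos (2 * (n + 1) * x) := by
      simp only [sinQuot, Finset.sum_range_succ]; ring
    rw [h, add_mul, ih]
    have h1 := sin_add (2 * (n + 1) * x) x
    have h2 := sin_sub (2 * (n + 1) * x) x
    have e1 : (2 * ((n + 1 : ℕ) : ℝ) + 1) * x = 2 * (n + 1) * x + x := by push_cast; ring
    have e2 : (2 * (n : ℝ) + 1) * x = 2 * (n + 1) * x - x := by ring
    rw [e1, e2, h1, h2]; ring

lemma integral_cos_mul_of_sin_eq_zero {k : ℝ} (hk : k ≠ 0) (h : sin (k * π) = 0) :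
    ∫ x in (-π)..π, cos (k * x) = 0 := by
  rw [integral_comp_mul_left (fun x => cos x) hk, integral_cos]
  simp [h]

lemma integral_sinQuot (n : ℕ) : ∫ x in (-π)..π, sinQuot n x = 2 * π := by
  unfold sinQuot
  rw [intervalIntegral.integral_add (by simp) (by apply Continuous.intervalIntegrable; fun_prop),
    intervalIntegral.integral_const_mul, intervalIntegral.integral_finsetSum
      (fun j _ => by apply Continuous.intervalIntegrable; fun_prop)]
  rw [Finset.sum_eq_zero]
  · simp; ring
  · intro j _
    apply integral_cos_mul_of_sin_eq_zero (by positivity)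
    have := sin_nat_mul_pi (2 * (j + 1))
    push_cast at this; exact this

/-- Integration by parts: since `(log tan (x/2))' = 1 / sin x`, the derivative of `sin ((2n+1)x)
logTan x / (2n+1)` is the integrand plus `sinQuot n x / (2n+1)`. The boundary terms vanish and
`sinQuot n` has integral `2π`. -/
lemma integral_logTan_mul_cos (n : ℕ) :
    ∫ x in (-π)..π, logTan x * cos ((2 * n + 1) * x) = -(2 * π) / (2 * n + 1) := by
  have hk : (2 * (n : ℝ) + 1) ≠ 0 := by positivity
  -- The antiderivative, rewritten through `s log s` expressions so that it is visibly continuous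
  -- across the singularities at `0` and `±π`.
  set P : ℝ → ℝ := fun x => (2 / (2 * (n : ℝ) + 1)) * sinQuot n x *
    (cos (x / 2) * (sin (x / 2) * log (sin (x / 2))) - sin (x / 2) * (cos (x / 2) * log (cos (x / 2))))
    with hP
  have hPc : Continuous P := by
    have h1 : Continuous fun x : ℝ => sin (x / 2) * log (sin (x / 2)) :=
      continuous_mul_log.comp (by fun_prop : Continuous fun x : ℝ => sin (x / 2))
    have h2 : Continuous fun x : ℝ => cos (x / 2) * log (cos (x / 2)) :=
      continuous_mul_log.comp (by fun_prop : Continuous fun x : ℝ => cos (x / 2))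
    have h3 := continuous_sinQuot n
    exact (continuous_const.mul h3).mul (((by fun_prop : Continuous fun x : ℝ => cos (x / 2)).mul h1).sub
      ((by fun_prop : Continuous fun x : ℝ => sin (x / 2)).mul h2))
  have key : ∀ x, sin (x / 2) ≠ 0 → cos (x / 2) ≠ 0 →
      P x = sin ((2 * n + 1) * x) * logTan x / (2 * n + 1) := by
    intro x hs hc
    rw [hP, logTan_eq, log_div hs hc, ← sinQuot_mul_sin, show sin x = sin (2 * (x / 2)) by ring_nf,
      sin_two_mul]
    ring
  have hnz : ∀ x ∈ Ioo (-π) π \ {0}, sin (x / 2) ≠ 0 ∧ cos (x / 2) ≠ 0 := by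
    rintro x ⟨⟨h1, h2⟩, h0⟩
    refine ⟨fun h => h0 ?_, (cos_pos_of_mem_Ioo ⟨by linarith, by linarith⟩).ne'⟩
    have := (sin_eq_zero_iff_of_lt_of_lt (by linarith [pi_pos]) (by linarith [pi_pos])).1 h
    simp only [mem_singleton_iff]; linarith
  have hder : ∀ x ∈ Ioo (-π) π \ {0}, HasDerivAt P
      (logTan x * cos ((2 * n + 1) * x) + sinQuot n x / (2 * n + 1)) x := by
    intro x hx
    obtain ⟨hs, hc⟩ := hnz x hx
    have hopen : IsOpen (Ioo (-π) π \ {0}) := isOpen_Ioo.sdiff isClosed_singleton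
    have hev : P =ᶠ[𝓝 x] fun x => sin ((2 * n + 1) * x) * logTan x / (2 * n + 1) := by
      filter_upwards [hopen.mem_nhds hx] with y hy
      exact key y (hnz y hy).1 (hnz y hy).2
    refine HasDerivAt.congr_of_eventuallyEq ?_ hev
    have ht : tan (x / 2) ≠ 0 := by rw [tan_eq_sin_div_cos]; exact div_ne_zero hs hc
    have d1 : HasDerivAt (fun y : ℝ => y / 2) (1 / 2) x := (hasDerivAt_id x).div_const 2
    have d2' : HasDerivAt (fun y : ℝ => tan (y / 2)) (1 / cos (x / 2) ^ 2 * (1 / 2)) x :=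
      HasDerivAt.comp x (h₂ := tan) (hasDerivAt_tan hc) d1
    have d2 : HasDerivAt logTan (1 / cos (x / 2) ^ 2 * (1 / 2) / tan (x / 2)) x :=
      d2'.log ht
    have d3 : HasDerivAt (fun y : ℝ => sin ((2 * n + 1) * y))
        (cos ((2 * n + 1) * x) * ((2 * n + 1) * 1)) x :=
      ((hasDerivAt_id x).const_mul (2 * (n : ℝ) + 1)).sin
    refine ((d3.mul d2).div_const (2 * (n : ℝ) + 1)).congr_deriv ?_
    rw [← sinQuot_mul_sin n x, show sin x = sin (2 * (x / 2)) by ring_nf, sin_two_mul,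
      tan_eq_sin_div_cos]
    field_simp
  have hint1 : IntervalIntegrable (fun x => logTan x * cos ((2 * n + 1) * x)) volume (-π) π :=
    (intervalIntegrable_logTan _ _).mul_continuousOn (by fun_prop)
  have hint2 : IntervalIntegrable (fun x => sinQuot n x / (2 * n + 1)) volume (-π) π :=
    ((continuous_sinQuot n).div_const _).intervalIntegrable _ _
  have h := integral_eq_of_hasDerivAt_off_countable_of_le P _ (by linarith [pi_pos] : -π ≤ π)
    (countable_singleton 0) hPc.continuousOn hder (hint1.add hint2)
  rw [intervalIntegral.integral_add hint1 hint2, intervalIntegral.integral_div, integral_sinQuot] at h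
  have e1 : P π = 0 := by simp [hP]
  have e2 : P (-π) = 0 := by simp [hP, neg_div]
  rw [e1, e2] at h
  rw [neg_div]; linarith

lemma integral_logTan_mul_sin (k : ℝ) : ∫ x in (-π)..π, logTan x * sin (k * x) = 0 := by
  have h := integral_comp_neg (fun x => logTan x * sin (k * x)) (a := -π) (b := π)
  simp only [logTan_neg, mul_neg, sin_neg, intervalIntegral.integral_neg, neg_neg] at h
  linarith

lemma sin_odd_mul_periodic (n : ℕ) (t : ℝ) :
    Function.Periodic (fun x => sin ((2 * (n : ℝ) + 1) * (x - t))) (2 * π) := fun x => by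
  have h := sin_add_nat_mul_two_pi ((2 * (n : ℝ) + 1) * (x - t)) (2 * n + 1)
  push_cast at h
  simp only
  rw [← h]; ring_nf

/-- Periodicity moves the shift `t` from the kernel to the sine. After the addition formula only the
cosine coefficient of `logTan` survives, because `logTan` is even. -/
lemma integral_logTan_add_mul_sin (n : ℕ) (t : ℝ) :
    ∫ s in (-π)..π, logTan (t + s) * sin ((2 * n + 1) * s) =
      2 * π / (2 * n + 1) * sin ((2 * n + 1) * t) := by
  have h1 : ∫ s in (-π)..π, logTan (t + s) * sin ((2 * n + 1) * s) =
      ∫ x in (t + -π)..(t + π), logTan x * sin ((2 * n + 1) * (x - t)) := by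
    rw [← integral_comp_add_left (fun x => logTan x * sin ((2 * n + 1) * (x - t)))]
    simp
  have h2 := (logTan_periodic.mul (sin_odd_mul_periodic n t)).intervalIntegral_add_eq (t + -π) (-π)
  rw [h1, show t + π = t + -π + 2 * π by ring]
  simp only [Pi.mul_apply] at h2
  rw [h2, show -π + 2 * π = π by ring]
  have h3 : ∀ x, logTan x * sin ((2 * n + 1) * (x - t)) =
      cos ((2 * n + 1) * t) * (logTan x * sin ((2 * n + 1) * x)) -
        sin ((2 * n + 1) * t) * (logTan x * cos ((2 * n + 1) * x)) := fun x => by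
    rw [mul_sub, sin_sub]; ring
  simp only [h3]
  rw [intervalIntegral.integral_sub
    (((intervalIntegrable_logTan _ _).mul_continuousOn (by fun_prop)).const_mul _)
    (((intervalIntegrable_logTan _ _).mul_continuousOn (by fun_prop)).const_mul _),
    intervalIntegral.integral_const_mul, intervalIntegral.integral_const_mul, integral_logTan_mul_sin,
    integral_logTan_mul_cos]
  ring

/-! ### The Green kernel of `|D|` -/

/-- The kernel of `2π |D|⁻¹` on the odd functions on the circle with odd frequencies. -/
def green (t s : ℝ) : ℝ := log ((sin t + sin s) / (sin t - sin s))

/-- By the sum-to-product formulas the quotient inside the logarithm equals `tan ((t+s)/2) / tan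
((t-s)/2)`. -/
lemma green_eq {t s : ℝ} (h : sin t ≠ sin s) (h' : sin t + sin s ≠ 0) :
    green t s = logTan (t + s) - logTan (t - s) := by
  have e1 : sin t + sin s = 2 * sin ((t + s) / 2) * cos ((t - s) / 2) := by
    have h1 := sin_add ((t + s) / 2) ((t - s) / 2)
    have h2 := sin_sub ((t + s) / 2) ((t - s) / 2)
    ring_nf at h1 h2 ⊢; linarith
  have e2 : sin t - sin s = 2 * sin ((t - s) / 2) * cos ((t + s) / 2) := by
    have h1 := sin_add ((t + s) / 2) ((t - s) / 2)
    have h2 := sin_sub ((t + s) / 2) ((t - s) / 2)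
    ring_nf at h1 h2 ⊢; linarith
  have n2 := sub_ne_zero.2 h
  have n1 := h'
  rw [e2] at n2; rw [e1] at n1
  simp only [mul_ne_zero_iff] at n1 n2
  rw [green, e1, e2, logTan_eq, logTan_eq, log_div n1.1.2 n2.2, log_div n2.1.2 n1.2,
    log_div (by simp [n1]) (by simp [n2]),
    log_mul (mul_ne_zero two_ne_zero n1.1.2) n1.2, log_mul (mul_ne_zero two_ne_zero n2.1.2) n2.2,
    log_mul two_ne_zero n1.1.2, log_mul two_ne_zero n2.1.2]
  ring

lemma green_symm (t s : ℝ) : green t s = green s t := by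
  rw [green, green, ← log_neg_eq_log, ← div_neg, neg_sub, add_comm]

/-- The kernel sees `t` only through `sin t`. Hence functions produced by the integral operator are
automatically odd and `π`-antiperiodic on the whole line. -/
lemma green_neg_of_sin {t t' s : ℝ} (h : sin t' = -sin t) : green t' s = -green t s := by
  rw [green, green, h, ← log_inv, inv_div, show -sin t + sin s = -(sin t - sin s) by ring,
    show -sin t - sin s = -(sin t + sin s) by ring, neg_div_neg_eq]

lemma measurable_green : Measurable (Function.uncurry green) := by
  unfold green Function.uncurry; fun_prop

/-- For nonnegative sines `|sin t - sin s| ≤ sin t + sin s`. This sign is what makes the integral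
operator order preserving. On the diagonal the value is `0` by the conventions for division and
`log`. -/
lemma green_nonneg {t s : ℝ} (ht : 0 ≤ sin t) (hs : 0 ≤ sin s) : 0 ≤ green t s := by
  by_cases h : sin t = sin s
  · simp [green, h]
  rw [green, ← log_abs]
  apply log_nonneg
  rw [abs_div, one_le_div (abs_pos.2 (sub_ne_zero.2 h)), abs_of_nonneg (add_nonneg ht hs)]
  rw [abs_le]; constructor <;> linarith

lemma ae_sin_ne (r : ℝ) : ∀ᵐ s : ℝ, sin s ≠ r := by
  have h : {s : ℝ | sin s = r}.Countable := by
    by_cases hr : ∃ t, sin t = r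
    · obtain ⟨t, rfl⟩ := hr
      refine ((countable_range (fun n : ℤ => 2 * n * π + t)).union
        (countable_range (fun n : ℤ => (2 * n + 1) * π - t))).mono fun s hs => ?_
      obtain ⟨n, hn⟩ := sin_eq_sin_iff.1 (hs : sin s = sin t).symm
      rcases hn with hn | hn
      · exact Or.inl ⟨n, hn.symm⟩
      · exact Or.inr ⟨n, hn.symm⟩
    · convert countable_empty (α := ℝ)
      ext s; simp; exact fun hs => hr ⟨s, hs⟩
  simpa using h.ae_notMem volume

lemma ae_green_eq (t : ℝ) : ∀ᵐ s : ℝ, green t s = logTan (t + s) - logTan (t - s) := by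
  filter_upwards [ae_sin_ne (sin t), ae_sin_ne (-sin t)] with s h1 h2
  exact green_eq (Ne.symm h1) (fun h => h2 (by linarith))

lemma intervalIntegrable_logTan_add (t a b : ℝ) :
    IntervalIntegrable (fun s => logTan (t + s)) volume a b := by
  simpa using (intervalIntegrable_logTan (t + a) (t + b)).comp_add_left t

lemma intervalIntegrable_logTan_sub (t a b : ℝ) :
    IntervalIntegrable (fun s => logTan (t - s)) volume a b := by
  simpa using (intervalIntegrable_logTan (t - a) (t - b)).comp_sub_left t

lemma intervalIntegrable_green (t a b : ℝ) : IntervalIntegrable (green t) volume a b :=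
  ((intervalIntegrable_logTan_add t a b).sub (intervalIntegrable_logTan_sub t a b)).congr_ae
    (ae_restrict_of_ae ((ae_green_eq t).mono fun _ h => h.symm))

/-- Reflecting `s ↦ -s` turns the `logTan (t - s)` half of the kernel into the missing half of the
integral of `logTan (t + s)` over a full period. The odd sines are therefore eigenfunctions with
eigenvalues those of `2π |D|⁻¹`. -/
lemma integral_green_mul_sin (n : ℕ) (t : ℝ) :
    ∫ s in (0)..π, green t s * sin ((2 * n + 1) * s) =
      2 * π / (2 * n + 1) * sin ((2 * n + 1) * t) := by
  rw [← integral_logTan_add_mul_sin]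
  have hi : ∀ a b, IntervalIntegrable (fun s => logTan (t + s) * sin ((2 * n + 1) * s)) volume a b :=
    fun a b => (intervalIntegrable_logTan_add t a b).mul_continuousOn (by fun_prop)
  have hi' : ∀ a b, IntervalIntegrable (fun s => logTan (t - s) * sin ((2 * n + 1) * s)) volume a b :=
    fun a b => (intervalIntegrable_logTan_sub t a b).mul_continuousOn (by fun_prop)
  rw [← integral_add_adjacent_intervals (hi (-π) 0) (hi 0 π)]
  have h1 : ∫ s in (-π)..0, logTan (t + s) * sin ((2 * n + 1) * s) =
      -∫ s in (0)..π, logTan (t - s) * sin ((2 * n + 1) * s) := by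
    have := integral_comp_neg (fun s => logTan (t + s) * sin ((2 * n + 1) * s)) (a := 0) (b := π)
    rw [neg_zero] at this
    rw [← this, ← intervalIntegral.integral_neg]
    congr 1; ext s
    rw [mul_neg, sin_neg, ← sub_eq_add_neg]; ring
  rw [h1, neg_add_eq_sub, ← intervalIntegral.integral_sub (hi _ _) (hi' _ _)]
  apply intervalIntegral.integral_congr_ae
  filter_upwards [ae_green_eq t] with s hs _
  rw [hs]; ring

/-- A uniform bound for the integrals of the kernel. -/
def greenBound : ℝ := ∫ x in (-π)..π, |logTan x|

lemma greenBound_nonneg : 0 ≤ greenBound :=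
  intervalIntegral.integral_nonneg (by linarith [pi_pos]) fun _ _ => abs_nonneg _

/-- The same reflection: the two pieces of the kernel over `[0, π]` together cover one period of
`|logTan|`, whatever `t` is. -/
lemma integral_abs_green_le (t : ℝ) : ∫ s in (0)..π, |green t s| ≤ greenBound := by
  have hi := fun a b => (intervalIntegrable_logTan_add t a b).abs
  have hi' := fun a b => (intervalIntegrable_logTan_sub t a b).abs
  have h0 : greenBound = ∫ s in (-π)..π, |logTan (t + s)| := by
    have hp : Function.Periodic (fun x => |logTan x|) (2 * π) := fun x => by
      simp only [logTan_periodic x]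
    have h2 := hp.intervalIntegral_add_eq (t + -π) (-π)
    rw [integral_comp_add_left (fun x => |logTan x|), greenBound]
    rw [show t + π = t + -π + 2 * π by ring, h2, show -π + 2 * π = π by ring]
  rw [h0, ← integral_add_adjacent_intervals (hi (-π) 0) (hi 0 π)]
  have h1 : ∫ s in (-π)..0, |logTan (t + s)| = ∫ s in (0)..π, |logTan (t - s)| := by
    have := integral_comp_neg (fun s => |logTan (t + s)|) (a := 0) (b := π)
    rw [neg_zero] at this
    rw [← this]; simp only [sub_eq_add_neg]
  rw [h1, ← intervalIntegral.integral_add (hi' _ _) (hi _ _)]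
  refine intervalIntegral.integral_mono_ae pi_pos.le (intervalIntegrable_green t 0 π).abs
    ((hi' _ _).add (hi _ _)) ?_
  filter_upwards [ae_green_eq t] with s hs
  rw [hs, add_comm |logTan (t - s)|]
  exact abs_sub (logTan (t + s)) (logTan (t - s))

end Breather
end

noncomputable section
namespace Breather
open Real Set Filter Topology

/-! ### The sublinear fixed point equation -/

/-- The integral operator with kernel `green / 2π`. -/
def greenOp (f : ℝ → ℝ) (t : ℝ) : ℝ := (2 * π)⁻¹ * ∫ s in (0)..π, green t s * f s

/-- Measurable functions with values in `[0, B]` on `[0, π]`. -/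
structure IsAdmissible (B : ℝ) (f : ℝ → ℝ) : Prop where
  measurable : Measurable f
  nonneg : ∀ t ∈ Icc 0 π, 0 ≤ f t
  le : ∀ t ∈ Icc 0 π, f t ≤ B

lemma sin_nonneg_of_mem {t : ℝ} (h : t ∈ Icc 0 π) : 0 ≤ sin t := sin_nonneg_of_nonneg_of_le_pi h.1 h.2

variable {B : ℝ} {f g : ℝ → ℝ}

lemma IsAdmissible.intervalIntegrable (hf : IsAdmissible B f) (t : ℝ) :
    IntervalIntegrable (fun s => green t s * f s) volume 0 π := by
  have h := intervalIntegrable_green t 0 π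
  rw [intervalIntegrable_iff_integrableOn_Ioc_of_le pi_pos.le] at h ⊢
  refine h.mul_bdd (c := B) hf.measurable.aestronglyMeasurable ?_
  refine (ae_restrict_iff' measurableSet_Ioc).2 (.of_forall fun s hs => ?_)
  rw [norm_eq_abs, abs_of_nonneg (hf.nonneg s (Ioc_subset_Icc_self hs))]
  exact hf.le s (Ioc_subset_Icc_self hs)

lemma measurable_greenOp (hf : Measurable f) : Measurable (greenOp f) := by
  unfold greenOp
  refine measurable_const.mul ?_
  simp only [intervalIntegral.integral_of_le pi_pos.le]
  have : StronglyMeasurable (Function.uncurry fun t s => green t s * f s) :=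
    (measurable_green.mul (hf.comp measurable_snd)).stronglyMeasurable
  exact this.integral_prod_right.measurable

lemma IsAdmissible.abs_greenOp_le (hf : IsAdmissible B f) (t : ℝ) :
    |greenOp f t| ≤ greenBound * B := by
  have hB : 0 ≤ B := (hf.nonneg 0 ⟨le_rfl, pi_pos.le⟩).trans (hf.le 0 ⟨le_rfl, pi_pos.le⟩)
  rw [greenOp, abs_mul]
  have h1 : |∫ s in (0)..π, green t s * f s| ≤ greenBound * B := by
    refine (intervalIntegral.abs_integral_le_integral_abs pi_pos.le).trans ?_
    refine le_trans ?_ (mul_le_mul_of_nonneg_right (integral_abs_green_le t) hB)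
    rw [← intervalIntegral.integral_mul_const]
    refine intervalIntegral.integral_mono_on pi_pos.le (hf.intervalIntegrable t).abs
      ((intervalIntegrable_green t 0 π).abs.mul_const _) fun s hs => ?_
    rw [abs_mul, abs_of_nonneg (hf.nonneg s hs)]
    exact mul_le_mul_of_nonneg_left (hf.le s hs) (abs_nonneg _)
  have h2 : |(2 * π)⁻¹| ≤ 1 := by
    rw [abs_of_nonneg (by positivity)]
    exact inv_le_one_of_one_le₀ (by linarith [pi_gt_three])
  calc _ ≤ 1 * |∫ s in (0)..π, green t s * f s| := mul_le_mul_of_nonneg_right h2 (abs_nonneg _)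
    _ ≤ _ := by rwa [one_mul]

lemma greenOp_mono (hf : IsAdmissible B f) (hg : IsAdmissible B g) (hfg : ∀ t ∈ Icc 0 π, f t ≤ g t)
    {t : ℝ} (ht : t ∈ Icc 0 π) : greenOp f t ≤ greenOp g t := by
  refine mul_le_mul_of_nonneg_left ?_ (by positivity)
  refine intervalIntegral.integral_mono_on pi_pos.le (hf.intervalIntegrable t)
    (hg.intervalIntegrable t) fun s hs => ?_
  exact mul_le_mul_of_nonneg_left (hfg s hs)
    (green_nonneg (sin_nonneg_of_mem ht) (sin_nonneg_of_mem hs))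

lemma greenOp_nonneg (hf : IsAdmissible B f) {t : ℝ} (ht : t ∈ Icc 0 π) : 0 ≤ greenOp f t := by
  refine mul_nonneg (by positivity) (intervalIntegral.integral_nonneg pi_pos.le fun s hs => ?_)
  exact mul_nonneg (green_nonneg (sin_nonneg_of_mem ht) (sin_nonneg_of_mem hs)) (hf.nonneg s hs)

lemma greenOp_sin (t : ℝ) : greenOp sin t = sin t := by
  have h := integral_green_mul_sin 0 t
  simp only [CharP.cast_eq_zero, mul_zero, zero_add, one_mul, div_one] at h
  rw [greenOp, h, ← mul_assoc, inv_mul_cancel₀ (by positivity), one_mul]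

/-- The bound preserved by the monotone iteration. -/
def iterBound : ℝ := 1 + greenBound

lemma one_le_iterBound : 1 ≤ iterBound := by
  have := greenBound_nonneg; unfold iterBound; linarith

/-- The monotone iteration `u ↦ (greenOp u) ^ (1 / 3)` started at `sin`. -/
def iter : ℕ → ℝ → ℝ
  | 0 => sin
  | n + 1 => fun t => greenOp (iter n) t ^ (1 / 3 : ℝ)

lemma rpow_third_le {x y : ℝ} (hx : 0 ≤ x) (hy : 0 ≤ y) (h : x ≤ y ^ 3) : x ^ (1 / 3 : ℝ) ≤ y := by
  calc x ^ (1 / 3 : ℝ) ≤ (y ^ 3) ^ (1 / 3 : ℝ) := rpow_le_rpow hx h (by norm_num)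
    _ = y := by rw [← rpow_natCast, ← rpow_mul hy]; norm_num

lemma rpow_third_pow {x : ℝ} (hx : 0 ≤ x) : (x ^ (1 / 3 : ℝ)) ^ 3 = x := by
  rw [← rpow_natCast, ← rpow_mul hx]; norm_num

/-- Sublinearity gives the a priori bound: `iterBound` is at least `1` and at least `greenBound`, so
`greenBound * iterBound ≤ iterBound ^ 3`. -/
lemma isAdmissible_iter (n : ℕ) : IsAdmissible iterBound (iter n) := by
  induction n with
  | zero => exact ⟨measurable_sin, fun t ht => sin_nonneg_of_mem ht,
      fun t _ => (sin_le_one t).trans one_le_iterBound⟩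
  | succ n ih =>
    refine ⟨(measurable_greenOp ih.measurable).pow_const _,
      fun t ht => rpow_nonneg (greenOp_nonneg ih ht) _,
      fun t ht => rpow_third_le (greenOp_nonneg ih ht) (by linarith [one_le_iterBound]) ?_⟩
    have h1 := (le_abs_self _).trans (ih.abs_greenOp_le t)
    have h2 := one_le_iterBound
    have h3 : greenBound ≤ iterBound := by unfold iterBound; linarith
    have h4 := greenBound_nonneg
    nlinarith [mul_le_mul_of_nonneg_right h3 (by linarith : 0 ≤ iterBound),
      mul_le_mul_of_nonneg_left h2 (by positivity : 0 ≤ iterBound * iterBound)]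

/-- The start is a subsolution: `greenOp` fixes `sin`, and `r ≤ r^(1/3)` on `[0, 1]`. Monotonicity
of `greenOp` and of the cube root propagates the inequality. -/
lemma iter_le_succ (n : ℕ) {t : ℝ} (ht : t ∈ Icc 0 π) : iter n t ≤ iter (n + 1) t := by
  induction n generalizing t with
  | zero =>
    have h0 := sin_nonneg_of_mem ht
    change sin t ≤ greenOp sin t ^ (1 / 3 : ℝ)
    rw [greenOp_sin]
    calc sin t = sin t ^ (1 : ℝ) := (rpow_one _).symm
      _ ≤ sin t ^ (1 / 3 : ℝ) := rpow_le_rpow_of_exponent_ge' h0 (sin_le_one t) (by norm_num)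
          (by norm_num)
  | succ n ih =>
    exact rpow_le_rpow (greenOp_nonneg (isAdmissible_iter n) ht)
      (greenOp_mono (isAdmissible_iter n) (isAdmissible_iter (n + 1)) (fun s hs => ih hs) ht)
      (by norm_num)

/-- The limit of the monotone iteration. -/
def iterLim (t : ℝ) : ℝ := ⨆ n, iter n t

lemma tendsto_iter {t : ℝ} (ht : t ∈ Icc 0 π) :
    Tendsto (fun n => iter n t) atTop (𝓝 (iterLim t)) :=
  tendsto_atTop_ciSup (monotone_nat_of_le_succ fun n => iter_le_succ n ht)
    ⟨iterBound, by rintro _ ⟨n, rfl⟩; exact (isAdmissible_iter n).le t ht⟩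

lemma isAdmissible_iterLim : IsAdmissible iterBound iterLim :=
  ⟨.iSup fun n => (isAdmissible_iter n).measurable,
    fun _ ht => ge_of_tendsto' (tendsto_iter ht) fun n => (isAdmissible_iter n).nonneg _ ht,
    fun _ ht => le_of_tendsto' (tendsto_iter ht) fun n => (isAdmissible_iter n).le _ ht⟩

lemma sin_le_iterLim {t : ℝ} (ht : t ∈ Icc 0 π) : sin t ≤ iterLim t :=
  (monotone_nat_of_le_succ fun n => iter_le_succ n ht).ge_of_tendsto (tendsto_iter ht) 0

/-- Pass to the limit in the recursion, by dominated convergence with majorant `|green t s| *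
iterBound`. -/
lemma iterLim_pow_three {t : ℝ} (ht : t ∈ Icc 0 π) : iterLim t ^ 3 = greenOp iterLim t := by
  have h1 : Tendsto (fun n => iter (n + 1) t ^ 3) atTop (𝓝 (iterLim t ^ 3)) :=
    ((tendsto_add_atTop_iff_nat 1).2 (tendsto_iter ht)).pow 3
  refine tendsto_nhds_unique h1 ?_
  have h2 : ∀ n, iter (n + 1) t ^ 3 = greenOp (iter n) t := fun n =>
    rpow_third_pow (greenOp_nonneg (isAdmissible_iter n) ht)
  simp only [h2]
  refine Tendsto.const_mul _ ?_
  refine intervalIntegral.tendsto_integral_filter_of_dominated_convergence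
    (fun s => |green t s| * iterBound) (.of_forall fun n => ?_) (.of_forall fun n => ?_)
    ((intervalIntegrable_green t 0 π).abs.mul_const _) (.of_forall fun s hs => ?_)
  · exact ((measurable_green.comp measurable_prodMk_left).mul
      (isAdmissible_iter n).measurable).aestronglyMeasurable
  · refine .of_forall fun s hs => ?_
    rw [uIoc_of_le pi_pos.le] at hs
    rw [norm_eq_abs, abs_mul, abs_of_nonneg ((isAdmissible_iter n).nonneg s (Ioc_subset_Icc_self hs))]
    exact mul_le_mul_of_nonneg_left ((isAdmissible_iter n).le s (Ioc_subset_Icc_self hs))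
      (abs_nonneg _)
  · rw [uIoc_of_le pi_pos.le] at hs
    exact (tendsto_iter (Ioc_subset_Icc_self hs)).const_mul _

lemma greenOp_neg_of_sin {t t' : ℝ} (h : sin t' = -sin t) : greenOp f t' = -greenOp f t := by
  simp only [greenOp, green_neg_of_sin h, neg_mul, intervalIntegral.integral_neg, mul_neg]

/-- Fubini and the symmetry of the kernel move the operator onto the sine, which is an
eigenfunction. This is the coefficient form of `|D| (greenOp f) = f`. -/
lemma integral_greenOp_mul_sin (hf : IsAdmissible B f) (n : ℕ) :
    (2 * n + 1) * ∫ t in (0)..π, greenOp f t * sin ((2 * n + 1) * t) =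
      ∫ t in (0)..π, f t * sin ((2 * n + 1) * t) := by
  have hk : (2 * (n : ℝ) + 1) ≠ 0 := by positivity
  set μ := (volume : Measure ℝ).restrict (Ioc 0 π)
  have hB : 0 ≤ B := (hf.nonneg 0 ⟨le_rfl, pi_pos.le⟩).trans (hf.le 0 ⟨le_rfl, pi_pos.le⟩)
  have hG : Integrable (Function.uncurry fun t s => green t s * f s) (μ.prod μ) := by
    have hm : Measurable (Function.uncurry fun t s => green t s * f s) :=
      measurable_green.mul (hf.measurable.comp measurable_snd)
    rw [integrable_prod_iff hm.aestronglyMeasurable]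
    refine ⟨.of_forall fun t => (hf.intervalIntegrable t).1, ?_⟩
    have hm : StronglyMeasurable (Function.uncurry fun t s => ‖green t s * f s‖) :=
      (measurable_green.mul (hf.measurable.comp measurable_snd)).norm.stronglyMeasurable
    refine Integrable.mono' (g := fun _ => greenBound * B) (integrable_const _)
      hm.integral_prod_right.aestronglyMeasurable (.of_forall fun t => ?_)
    rw [norm_of_nonneg (integral_nonneg fun _ => norm_nonneg _)]
    have := integral_abs_green_le t
    rw [intervalIntegral.integral_of_le pi_pos.le] at this
    refine le_trans ?_ (mul_le_mul_of_nonneg_right this hB)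
    rw [← integral_mul_const]
    refine integral_mono_ae (hf.intervalIntegrable t).1.norm
      ((intervalIntegrable_green t 0 π).1.norm.mul_const _) ?_
    refine (ae_restrict_iff' measurableSet_Ioc).2 (.of_forall fun s hs => ?_)
    simp only [Function.uncurry, norm_mul, norm_eq_abs, abs_of_nonneg (hf.nonneg s (Ioc_subset_Icc_self hs))]
    exact mul_le_mul_of_nonneg_left (hf.le s (Ioc_subset_Icc_self hs)) (abs_nonneg _)
  have hG' : Integrable (Function.uncurry fun t s => green t s * f s * sin ((2 * n + 1) * t))
      (μ.prod μ) := by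
    refine hG.mul_bdd (c := 1) (g := fun p : ℝ × ℝ => sin ((2 * (n : ℝ) + 1) * p.1))
      (by fun_prop) (.of_forall fun p => ?_)
    rw [norm_eq_abs]; exact abs_sin_le_one _
  have h1 : ∀ t, greenOp f t * sin ((2 * n + 1) * t) =
      (2 * π)⁻¹ * ∫ s, green t s * f s * sin ((2 * n + 1) * t) ∂μ := fun t => by
    rw [greenOp, integral_mul_const, intervalIntegral.integral_of_le pi_pos.le]; ring
  simp only [h1]
  rw [intervalIntegral.integral_const_mul, intervalIntegral.integral_of_le pi_pos.le,
    integral_integral_swap hG']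
  have h2 : ∀ s, ∫ t, green t s * f s * sin ((2 * n + 1) * t) ∂μ =
      f s * (2 * π / (2 * n + 1) * sin ((2 * n + 1) * s)) := fun s => by
    rw [← integral_green_mul_sin, intervalIntegral.integral_of_le pi_pos.le, ← integral_const_mul]
    congr 1; ext t
    rw [green_symm t s]; ring
  simp only [h2]
  rw [intervalIntegral.integral_of_le pi_pos.le, ← integral_const_mul, ← integral_const_mul]
  congr 1; ext s
  field_simp

/-! ### Extension of the fixed point to a profile on the circle -/

lemma integral_two_pi_of_periodic {h : ℝ → ℝ} (hp : Function.Periodic h π)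
    (hi : ∀ a b, IntervalIntegrable h volume a b) :
    ∫ t in (0)..(2 * π), h t = 2 * ∫ t in (0)..π, h t := by
  rw [← intervalIntegral.integral_add_adjacent_intervals (hi 0 π) (hi π (2 * π))]
  have := hp.intervalIntegral_add_eq π 0
  rw [zero_add, ← two_mul] at this
  rw [this]; ring

/-- The odd cube root. -/
def cbrt (x : ℝ) : ℝ := if 0 ≤ x then x ^ (1 / 3 : ℝ) else -(-x) ^ (1 / 3 : ℝ)

lemma cbrt_pow_three (x : ℝ) : cbrt x ^ 3 = x := by
  unfold cbrt; split_ifs with h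
  · exact rpow_third_pow h
  · rw [Odd.neg_pow (by decide), rpow_third_pow (by linarith), neg_neg]

lemma eq_cbrt_iff {x y : ℝ} : y = cbrt x ↔ y ^ 3 = x := by
  constructor
  · rintro rfl; exact cbrt_pow_three x
  · intro h; exact (Odd.strictMono_pow (by decide : Odd 3)).injective (by simp only [h, cbrt_pow_three])

lemma cbrt_neg (x : ℝ) : cbrt (-x) = -cbrt x :=
  (eq_cbrt_iff.2 (by rw [Odd.neg_pow (by decide), cbrt_pow_three])).symm

lemma measurable_cbrt : Measurable cbrt :=
  Measurable.ite measurableSet_Ici (by fun_prop) (by fun_prop)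

lemma abs_cbrt_le (x : ℝ) : |cbrt x| ≤ 1 + |x| := by
  have h : |cbrt x| ^ 3 = |x| := by rw [← abs_pow, cbrt_pow_three]
  have h0 := abs_nonneg (cbrt x)
  rw [← h]
  nlinarith [sq_nonneg (|cbrt x| - 1), mul_nonneg h0 (sq_nonneg (|cbrt x| - 1))]

/-- Existence of a nontrivial bounded `U` with `|D| U³ = U`, `U` odd with odd frequencies only;
the equation is expressed through the sine coefficients. -/
theorem exists_profile : ∃ U : ℝ → ℝ, Measurable U ∧ (∃ B, ∀ t, |U t| ≤ B) ∧
    (∀ t, U (-t) = -U t) ∧ (∀ t, U (t + π) = -U t) ∧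
    (∀ n : ℕ, (2 * n + 1) * ∫ t in (0)..(2 * π), U t ^ 3 * sin ((2 * n + 1) * t) =
      ∫ t in (0)..(2 * π), U t * sin ((2 * n + 1) * t)) ∧
    0 < ∫ t in (0)..(2 * π), U t * sin t := by
  have hu := isAdmissible_iterLim
  set y := greenOp iterLim with hy
  -- The formula for `greenOp iterLim` makes sense for every real `t` and already has the right
  -- symmetries, so its odd cube root extends `iterLim` from `[0, π]` without any case distinction.
  set U : ℝ → ℝ := fun t => cbrt (y t) with hU
  have hUm : Measurable U := measurable_cbrt.comp (measurable_greenOp hu.measurable)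
  have hUb : ∀ t, |U t| ≤ 1 + greenBound * iterBound := fun t =>
    (abs_cbrt_le _).trans (by linarith [hu.abs_greenOp_le t])
  have hUpi : ∀ t, U (t + π) = -U t := fun t => by
    simp only [hU, hy]; rw [greenOp_neg_of_sin (sin_add_pi t), cbrt_neg]
  have hU3 : ∀ t, U t ^ 3 = y t := fun t => cbrt_pow_three _
  have hUu : ∀ t ∈ Icc 0 π, U t = iterLim t := fun t ht =>
    (eq_cbrt_iff.2 (iterLim_pow_three ht)).symm
  have hsin : ∀ (n : ℕ) (t : ℝ), sin ((2 * n + 1) * (t + π)) = -sin ((2 * n + 1) * t) := fun n t => by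
    have h := sin_add_nat_mul_two_pi ((2 * (n : ℝ) + 1) * t + π) n
    rw [sin_add_pi] at h
    rw [← h]; ring_nf
  have hb : ∀ (V : ℝ → ℝ) (C : ℝ), Measurable V → (∀ t, |V t| ≤ C) → ∀ (n : ℕ) (a b : ℝ),
      IntervalIntegrable (fun t => V t * sin ((2 * n + 1) * t)) volume a b := fun V C hV hC n a b => by
    refine (intervalIntegrable_const (c := C)).mono_fun (by fun_prop) (.of_forall fun t => ?_)
    simp only [norm_mul, norm_eq_abs]
    have h1 := abs_sin_le_one ((2 * n + 1) * t)
    have h2 := hC t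
    have h3 := abs_nonneg (V t)
    calc _ ≤ |V t| * 1 := mul_le_mul_of_nonneg_left h1 h3
      _ ≤ _ := by rw [mul_one]; exact h2.trans (le_abs_self C)
  have hU3b : ∀ t, |U t ^ 3| ≤ greenBound * iterBound := fun t => by
    rw [hU3]; exact hu.abs_greenOp_le t
  have hint : ∀ n : ℕ, ∫ t in (0)..(2 * π), U t * sin ((2 * n + 1) * t) =
      2 * ∫ t in (0)..π, iterLim t * sin ((2 * n + 1) * t) := fun n => by
    rw [integral_two_pi_of_periodic (fun t => by simp only [hUpi, hsin, neg_mul_neg])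
      (hb U _ hUm hUb n)]
    congr 1
    refine intervalIntegral.integral_congr fun t ht => ?_
    rw [uIcc_of_le pi_pos.le] at ht
    simp only [hUu t ht]
  refine ⟨U, hUm, ⟨_, hUb⟩, fun t => ?_, hUpi, fun n => ?_, ?_⟩
  · simp only [hU, hy]; rw [greenOp_neg_of_sin (sin_neg t), cbrt_neg]
  · rw [hint, ← integral_greenOp_mul_sin hu, integral_two_pi_of_periodic (fun t => by
      simp only [hUpi, hsin]; ring) (hb (fun t => U t ^ 3) _ (hUm.pow_const 3) hU3b n)]
    simp only [hU3]; ring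
  · have h := hint 0
    simp only [CharP.cast_eq_zero, mul_zero, zero_add, one_mul] at h
    rw [h]
    -- Nontriviality: the limit stays above the starting function `sin`, so its first coefficient is
    -- at least `∫ sin² = π / 2`.
    have h1 : ∫ t in (0)..π, sin t ^ 2 ≤ ∫ t in (0)..π, iterLim t * sin t := by
      have hi : IntervalIntegrable (fun t => iterLim t * sin t) volume 0 π := by
        have h2 := hb U _ hUm hUb 0 0 π
        simp only [CharP.cast_eq_zero, mul_zero, zero_add, one_mul] at h2
        refine h2.congr fun t ht => ?_
        rw [uIoc_of_le pi_pos.le] at ht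
        simp only [hUu t (Ioc_subset_Icc_self ht)]
      refine intervalIntegral.integral_mono_on pi_pos.le
        ((by fun_prop : Continuous fun t => sin t ^ 2).intervalIntegrable _ _) hi fun t ht => ?_
      rw [sq]
      exact mul_le_mul_of_nonneg_right (sin_le_iterLim ht) (sin_nonneg_of_mem ht)
    rw [integral_sin_sq] at h1
    simp at h1
    linarith [pi_pos]

end Breather
end

noncomputable section
namespace Breather
open Real Set Filter Topology ComplexConjugate

/-! ### Parseval's identity for odd functions with odd frequencies -/

instance : Fact (0 < 2 * π) := ⟨two_pi_pos⟩

lemma fourierCoeff_liftIoc_two_pi (f : ℝ → ℝ) (n : ℤ) :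
    fourierCoeff (AddCircle.liftIoc (2 * π) 0 fun t => (f t : ℂ)) n =
      (2 * π)⁻¹ * ∫ t in (0)..(2 * π), Complex.exp (-(n * t * Complex.I)) * f t := by
  rw [fourierCoeff_liftIoc_eq, fourierCoeffOn_eq_integral]
  simp only [fourier_coe_apply, zero_add, sub_zero, one_div, smul_eq_mul, Complex.real_smul]
  push_cast
  congr 2; ext t
  congr 2
  have : (π : ℂ) ≠ 0 := by exact_mod_cast pi_ne_zero
  field_simp

lemma exp_mul_eq (k t r : ℝ) : Complex.exp (-(k * t * Complex.I)) * r =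
    ((r * cos (k * t) : ℝ) : ℂ) - ((r * sin (k * t) : ℝ) : ℂ) * Complex.I := by
  rw [show -((k : ℂ) * t * Complex.I) = ((-(k * t) : ℝ) : ℂ) * Complex.I by push_cast; ring,
    Complex.exp_mul_I, ← Complex.ofReal_cos, ← Complex.ofReal_sin, cos_neg, sin_neg]
  push_cast; ring

lemma intervalIntegrable_of_memLp {f : ℝ → ℝ} {T : ℝ} (hT : 0 ≤ T)
    (hf : MemLp f 2 (volume.restrict (Ioc 0 T))) : IntervalIntegrable f volume 0 T := by
  rw [intervalIntegrable_iff_integrableOn_Ioc_of_le hT]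
  exact hf.integrable (by norm_num)

/-- Parseval in polarized form, from the Fourier Hilbert basis. -/
lemma hasSum_conj_fourierCoeff_mul {T : ℝ} [Fact (0 < T)] {F G : AddCircle T → ℂ}
    (hF : MemLp F 2 AddCircle.haarAddCircle) (hG : MemLp G 2 AddCircle.haarAddCircle) :
    HasSum (fun k => conj (fourierCoeff F k) * fourierCoeff G k)
      (∫ a, conj (F a) * G a ∂AddCircle.haarAddCircle) := by
  have hs := (fourierBasis (T := T)).hasSum_inner_mul_inner hF.toLp hG.toLp
  have e1 : ∀ k, ∀ h : AddCircle T → ℂ, (hh : MemLp h 2 AddCircle.haarAddCircle) →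
      inner ℂ (fourierBasis (T := T) k) hh.toLp = fourierCoeff h k := fun k h hh => by
    rw [← HilbertBasis.repr_apply_apply, fourierBasis_repr]
    exact congrFun (fourierCoeff_congr_ae hh.coeFn_toLp) k
  have e2 : inner ℂ hF.toLp hG.toLp = ∫ a, conj (F a) * G a ∂AddCircle.haarAddCircle := by
    rw [L2.inner_def]
    refine integral_congr_ae ?_
    filter_upwards [hF.coeFn_toLp, hG.coeFn_toLp] with a h1 h2
    rw [h1, h2, RCLike.inner_apply, mul_comm]
  have e3 : ∀ k, inner ℂ hF.toLp (fourierBasis (T := T) k) = conj (fourierCoeff F k) := fun k => by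
    rw [← e1 k F hF, inner_conj_symm]
  simpa only [e1, e2, e3] using hs

/-- The real part of the complex identity, multiplied by `(2π)²` to clear the normalizations of the
coefficients. -/
theorem hasSum_parseval_real {f g : ℝ → ℝ} (hf : MemLp f 2 (volume.restrict (Ioc 0 (2 * π))))
    (hg : MemLp g 2 (volume.restrict (Ioc 0 (2 * π)))) :
    HasSum (fun k : ℤ =>
      (∫ t in (0)..(2 * π), f t * cos (k * t)) * (∫ t in (0)..(2 * π), g t * cos (k * t)) +
      (∫ t in (0)..(2 * π), f t * sin (k * t)) * (∫ t in (0)..(2 * π), g t * sin (k * t)))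
      (2 * π * ∫ t in (0)..(2 * π), f t * g t) := by
  have hcoeff : ∀ h : ℝ → ℝ, MemLp h 2 (volume.restrict (Ioc 0 (2 * π))) → ∀ k : ℤ,
      fourierCoeff (AddCircle.liftIoc (2 * π) 0 fun t => (h t : ℂ)) k =
      (2 * π)⁻¹ * ((∫ t in (0)..(2 * π), h t * cos (k * t) : ℝ) -
        (∫ t in (0)..(2 * π), h t * sin (k * t) : ℝ) * Complex.I) := fun h hh k => by
    rw [fourierCoeff_liftIoc_two_pi]
    have hi := intervalIntegrable_of_memLp two_pi_pos.le hh
    have e := fun t : ℝ => exp_mul_eq k t (h t)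
    simp only [Complex.ofReal_intCast] at e
    simp only [e]
    rw [intervalIntegral.integral_sub, intervalIntegral.integral_mul_const,
      intervalIntegral.integral_ofReal, intervalIntegral.integral_ofReal]
    · have h1 := hi.mul_continuousOn (g := fun t => cos (k * t)) (by fun_prop)
      exact ⟨h1.1.ofReal, h1.2.ofReal⟩
    · have h1 := hi.mul_continuousOn (g := fun t => sin (k * t)) (by fun_prop)
      exact IntervalIntegrable.mul_const ⟨h1.1.ofReal, h1.2.ofReal⟩ _
  have hL : ∀ h : ℝ → ℝ, MemLp h 2 (volume.restrict (Ioc 0 (2 * π))) →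
      MemLp (AddCircle.liftIoc (2 * π) 0 fun t => (h t : ℂ)) 2 AddCircle.haarAddCircle := fun h hh => by
    have h1 : MemLp (fun t => (h t : ℂ)) 2 (volume.restrict (Ioc 0 (0 + 2 * π))) := by
      rw [zero_add]; exact hh.ofReal
    exact h1.memLp_liftIoc.haarAddCircle
  have hs := hasSum_conj_fourierCoeff_mul (hL f hf) (hL g hg)
  have e2 : ∫ a, conj (AddCircle.liftIoc (2 * π) 0 (fun t => (f t : ℂ)) a) *
      AddCircle.liftIoc (2 * π) 0 (fun t => (g t : ℂ)) a ∂AddCircle.haarAddCircle =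
      (((2 * π)⁻¹ * ∫ t in (0)..(2 * π), f t * g t : ℝ) : ℂ) := by
    have : ∀ a, conj (AddCircle.liftIoc (2 * π) 0 (fun t => (f t : ℂ)) a) *
        AddCircle.liftIoc (2 * π) 0 (fun t => (g t : ℂ)) a =
        AddCircle.liftIoc (2 * π) 0 (fun t => ((f t * g t : ℝ) : ℂ)) a := fun a => by
      simp [AddCircle.liftIoc]
    simp only [this]
    rw [AddCircle.integral_haarAddCircle, AddCircle.integral_liftIoc_eq_intervalIntegral,
      zero_add, intervalIntegral.integral_ofReal]
    push_cast; simp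
  rw [e2] at hs
  have hr := (Complex.hasSum_re hs).mul_left ((2 * π) * (2 * π))
  rw [Complex.ofReal_re] at hr
  rw [mul_assoc (2 * π) (2 * π), mul_inv_cancel_left₀ two_pi_pos.ne'] at hr
  refine hr.congr_fun fun k => ?_
  rw [hcoeff f hf, hcoeff g hg]
  simp
  field_simp

variable {U : ℝ → ℝ}

lemma memLp_of_bounded {T B : ℝ} (hU : Measurable U) (hB : ∀ t, |U t| ≤ B) {p : ENNReal} :
    MemLp U p (volume.restrict (Ioc 0 T)) :=
  MemLp.of_bound hU.aestronglyMeasurable B (.of_forall hB)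

/-- The sine coefficients of a function with odd frequencies. -/
def sinCoeff (U : ℝ → ℝ) (n : ℕ) : ℝ := π⁻¹ * ∫ t in (0)..(2 * π), U t * sin ((2 * n + 1) * t)

lemma antiperiodic_add_two_pi (hpi : ∀ t, U (t + π) = -U t) : Function.Periodic U (2 * π) := fun t => by
  rw [show t + 2 * π = t + π + π by ring, hpi, hpi, neg_neg]

/-- Oddness of `U` kills the cosine coefficients and antiperiodicity the even sine coefficients. The
remaining frequencies `k` and `-k` contribute equally, which accounts for the `π⁻¹` in `sinCoeff`.
-/
theorem hasSum_sinCoeff (hm : Measurable U) {B : ℝ} (hB : ∀ t, |U t| ≤ B)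
    (hodd : ∀ t, U (-t) = -U t) (hpi : ∀ t, U (t + π) = -U t) {η : ℝ → ℝ}
    (hη : MemLp η 2 (volume.restrict (Ioc 0 (2 * π)))) :
    HasSum (fun n : ℕ => sinCoeff U n * ∫ t in (0)..(2 * π), η t * sin ((2 * n + 1) * t))
      (∫ t in (0)..(2 * π), U t * η t) := by
  have hU2 : MemLp U 2 (volume.restrict (Ioc 0 (2 * π))) := memLp_of_bounded hm hB
  have hper := antiperiodic_add_two_pi hpi
  have hcos : ∀ k : ℤ, ∫ t in (0)..(2 * π), U t * cos (k * t) = 0 := fun k => by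
    have h := intervalIntegral.integral_comp_sub_left (fun t => U t * cos (k * t)) (a := 0)
      (b := 2 * π) (2 * π)
    rw [sub_self, sub_zero] at h
    have h2 : ∀ t, U (2 * π - t) * cos (k * (2 * π - t)) = -(U t * cos (k * t)) := fun t => by
      rw [sub_eq_neg_add, hper (-t), hodd, show (k : ℝ) * (-t + 2 * π) = -(k * t) + k * (2 * π) by ring,
        cos_add_int_mul_two_pi, cos_neg]; ring
    simp only [h2, intervalIntegral.integral_neg] at h
    linarith
  have hi : ∀ a b, IntervalIntegrable U volume a b := fun a b =>
    (intervalIntegrable_const (c := B)).mono_fun hm.aestronglyMeasurable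
      (.of_forall fun t => by simpa only [norm_eq_abs] using (hB t).trans (le_abs_self B))
  have heven : ∀ k : ℤ, Even k → ∫ t in (0)..(2 * π), U t * sin (k * t) = 0 := fun k ⟨m, hk⟩ => by
    have hi' : ∀ a b, IntervalIntegrable (fun t => U t * sin (k * t)) volume a b := fun a b =>
      (hi a b).mul_continuousOn (by fun_prop)
    rw [← intervalIntegral.integral_add_adjacent_intervals (hi' 0 π) (hi' π (2 * π))]
    have h := intervalIntegral.integral_comp_add_right (fun t => U t * sin (k * t)) (a := 0)
      (b := π) π
    rw [zero_add, ← two_mul] at h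
    have h2 : ∀ t, U (t + π) * sin (k * (t + π)) = -(U t * sin (k * t)) := fun t => by
      rw [hpi, hk, show ((m + m : ℤ) : ℝ) * (t + π) = (m + m : ℤ) * t + m * (2 * π) by push_cast; ring,
        sin_add_int_mul_two_pi]; ring
    rw [← h]
    simp only [h2, intervalIntegral.integral_neg]
    ring
  have h := hasSum_parseval_real hU2 hη
  simp only [hcos, zero_mul, zero_add] at h
  -- Folding the sum over `ℤ` onto `ℕ` counts `k = 0` twice, harmlessly since that term is zero.
  have h1 := h.nat_add_neg
  simp only [Int.cast_neg, Int.cast_natCast, neg_mul, sin_neg, mul_neg, intervalIntegral.integral_neg,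
    neg_neg, Int.cast_zero, zero_mul, sin_zero, mul_zero, intervalIntegral.integral_zero,
    add_zero] at h1
  have hinj : Function.Injective (fun n : ℕ => 2 * n + 1) := fun a b hab => by simpa using hab
  rw [← hinj.hasSum_iff] at h1
  · have h2 := h1.mul_left (2 * π)⁻¹
    rw [inv_mul_cancel_left₀ two_pi_pos.ne'] at h2
    refine h2.congr_fun fun n => ?_
    simp only [sinCoeff, Function.comp]
    push_cast
    field_simp
    ring
  · intro k hk
    have : Even k := by
      by_contra hne
      obtain ⟨m, hm⟩ := Nat.not_even_iff_odd.1 hne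
      exact hk ⟨m, hm.symm⟩
    have := heven k (by exact_mod_cast this)
    simp only [Int.cast_natCast] at this
    simp [this]

/-- The case `η = U` of the expansion. -/
lemma summable_sinCoeff_sq (hm : Measurable U) {B : ℝ} (hB : ∀ t, |U t| ≤ B)
    (hodd : ∀ t, U (-t) = -U t) (hpi : ∀ t, U (t + π) = -U t) :
    Summable fun n => sinCoeff U n ^ 2 := by
  have h := (hasSum_sinCoeff hm hB hodd hpi (memLp_of_bounded hm hB)).summable.mul_left π⁻¹
  refine h.congr fun n => ?_
  rw [sinCoeff]; ring

end Breather
end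

/-! ### Rescaled expansions over several periods, and orthogonal series -/

noncomputable section
namespace Breather
open Real Set Filter Topology

/-- The time interval contains `N` periods of `F (Ω t)`. Since `η` need not have this shorter
period, each piece keeps its own translate of `η`. -/
lemma intervalIntegral_scaled_eq_sum {F η : ℝ → ℝ} (hF : Measurable F) {B : ℝ} (hB : ∀ t, |F t| ≤ B)
    (hper : Function.Periodic F (2 * π)) (hη : Continuous η) {Ω : ℝ} (hΩ : 0 < Ω) (N : ℕ) :
    ∫ t in (0)..(2 * π * N / Ω), F (Ω * t) * η t =
      Ω⁻¹ * ∑ j ∈ Finset.range N, ∫ t in (0)..(2 * π), F t * η ((t + 2 * π * j) / Ω) := by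
  have hi : ∀ a b, IntervalIntegrable (fun t => F t * η (t / Ω)) volume a b := fun a b => by
    have h1 : IntervalIntegrable F volume a b :=
      (intervalIntegrable_const (c := B)).mono_fun hF.aestronglyMeasurable
        (.of_forall fun t => by simpa only [norm_eq_abs] using (hB t).trans (le_abs_self B))
    exact h1.mul_continuousOn (by fun_prop)
  have h1 := intervalIntegral.integral_comp_mul_left (fun t => F t * η (t / Ω)) hΩ.ne' (a := 0)
    (b := 2 * π * N / Ω)
  simp only [mul_div_cancel_left₀ _ hΩ.ne', mul_zero, mul_div_cancel₀ _ hΩ.ne', smul_eq_mul] at h1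
  rw [h1]
  congr 1
  have h2 := intervalIntegral.sum_integral_adjacent_intervals (f := fun t => F t * η (t / Ω))
    (μ := volume) (a := fun j : ℕ => 2 * π * j) (n := N) fun k _ => hi _ _
  simp only [CharP.cast_eq_zero, mul_zero] at h2
  rw [← h2]
  refine Finset.sum_congr rfl fun j _ => ?_
  have h3 := intervalIntegral.integral_comp_add_right (fun t => F t * η (t / Ω)) (a := 0)
    (b := 2 * π) (2 * π * j)
  rw [zero_add, show 2 * π + 2 * π * (j : ℝ) = 2 * π * ((j + 1 : ℕ) : ℝ) by push_cast; ring] at h3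
  rw [← h3]
  congr 1; ext t
  have h4 := hper.nat_mul j t
  rw [show t + 2 * π * (j : ℝ) = t + j * (2 * π) by ring, h4]

lemma memLp_of_continuous {η : ℝ → ℝ} (hη : Continuous η) (T : ℝ) (p : ENNReal) :
    MemLp η p (volume.restrict (Ioc 0 T)) := by
  obtain ⟨C, hC⟩ := isCompact_Icc.exists_bound_of_continuousOn (s := Icc 0 T) hη.continuousOn
  exact MemLp.of_bound hη.aestronglyMeasurable C ((ae_restrict_iff' measurableSet_Ioc).2
    (.of_forall fun t ht => hC t (Ioc_subset_Icc_self ht)))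

theorem hasSum_sinCoeff_scaled {U : ℝ → ℝ} (hm : Measurable U) {B : ℝ} (hB : ∀ t, |U t| ≤ B)
    (hodd : ∀ t, U (-t) = -U t) (hpi : ∀ t, U (t + π) = -U t) {η : ℝ → ℝ} (hη : Continuous η)
    {Ω : ℝ} (hΩ : 0 < Ω) (N : ℕ) :
    HasSum (fun n : ℕ => sinCoeff U n *
        ∫ t in (0)..(2 * π * N / Ω), sin ((2 * n + 1) * (Ω * t)) * η t)
      (∫ t in (0)..(2 * π * N / Ω), U (Ω * t) * η t) := by
  rw [intervalIntegral_scaled_eq_sum hm hB (antiperiodic_add_two_pi hpi) hη hΩ]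
  have h1 : ∀ n : ℕ, ∫ t in (0)..(2 * π * N / Ω), sin ((2 * n + 1) * (Ω * t)) * η t = _ := fun n =>
    intervalIntegral_scaled_eq_sum (F := fun t => sin ((2 * n + 1) * t)) (by fun_prop)
      (fun t => abs_sin_le_one _)
      (fun t => by simpa using sin_odd_mul_periodic n 0 t) hη hΩ N
  simp only [h1, mul_left_comm (sinCoeff U _)]
  refine HasSum.mul_left _ ?_
  simp only [Finset.mul_sum]
  refine hasSum_sum fun j _ => ?_
  have hc : Continuous fun t => η ((t + 2 * π * j) / Ω) := by fun_prop
  have h2 := hasSum_sinCoeff hm hB hodd hpi (memLp_of_continuous hc (2 * π) 2)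
  simpa only [mul_comm (sin _) _] using h2

/-! ### Orthogonal series in `L²` -/

/-- A square summable orthogonal series converges in `L²`; in particular its pairing with any
`L²` function may be evaluated termwise. -/
theorem exists_memLp_hasSum_of_orthogonal {α : Type*} [MeasurableSpace α] {μ : Measure α}
    {f : ℕ → α → ℝ} (hf : ∀ n, MemLp (f n) 2 μ) (ho : ∀ m n, m ≠ n → ∫ x, f m x * f n x ∂μ = 0)
    (hs : Summable fun n => ∫ x, f n x ^ 2 ∂μ) :
    ∃ F, MemLp F 2 μ ∧ ∀ g, MemLp g 2 μ → HasSum (fun n => ∫ x, f n x * g x ∂μ) (∫ x, F x * g x ∂μ) := by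
  have hin : ∀ u v : α → ℝ, (hu : MemLp u 2 μ) → (hv : MemLp v 2 μ) →
      inner ℝ hu.toLp hv.toLp = ∫ x, u x * v x ∂μ := fun u v hu hv => by
    rw [L2.inner_def]
    refine integral_congr_ae ?_
    filter_upwards [hu.coeFn_toLp, hv.coeFn_toLp] with x h1 h2
    rw [h1, h2, RCLike.inner_apply, mul_comm]; rfl
  set v : ℕ → Lp ℝ 2 μ := fun n => (hf n).toLp with hv
  -- Working with the lines spanned by the `v n` avoids normalizing vectors that may vanish, and
  -- gives access to the criterion that an orthogonal series converges when its squared norms are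
  -- summable.
  have hO : OrthogonalFamily ℝ (fun n => (ℝ ∙ v n : Submodule ℝ (Lp ℝ 2 μ)))
      fun n => (ℝ ∙ v n : Submodule ℝ (Lp ℝ 2 μ)).subtypeₗᵢ := by
    intro m n hmn x y
    obtain ⟨a, ha⟩ := Submodule.mem_span_singleton.1 x.2
    obtain ⟨b, hb⟩ := Submodule.mem_span_singleton.1 y.2
    change inner ℝ (x : Lp ℝ 2 μ) (y : Lp ℝ 2 μ) = 0
    rw [← ha, ← hb, inner_smul_left, inner_smul_right, hv]
    simp only [hin, ho m n hmn, mul_zero]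
  have hsum : Summable v := by
    have h1 := (hO.summable_iff_norm_sq_summable
      (fun n => ⟨v n, Submodule.mem_span_singleton_self _⟩)).2 (by
        refine hs.congr fun n => ?_
        rw [Submodule.coe_norm, ← real_inner_self_eq_norm_sq, hv]
        simp only [hin, sq])
    exact h1
  refine ⟨_, Lp.memLp (∑' n, v n), fun g hg => ?_⟩
  have h2 := hsum.hasSum.mapL (innerSL ℝ hg.toLp)
  have h3 : ∫ x, (∑' n, v n : Lp ℝ 2 μ) x * g x ∂μ = inner ℝ hg.toLp (∑' n, v n) := by
    have := hin _ _ hg (Lp.memLp (∑' n, v n))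
    rw [Lp.toLp_coeFn] at this
    rw [this]; simp only [mul_comm]
  rw [h3]
  refine h2.congr_fun fun n => ?_
  rw [innerSL_apply_apply, hv]
  simp only [hin, mul_comm]

end Breather
end

noncomputable section
namespace Breather
open Real Set Filter Topology

/-! ### The spatial profiles -/

/-- The decaying solution on the half line of `P'' = -μ² g P`, normalized by `P 0 = 1`, for `μ` with
`cos (√b μ c) = 0`. -/
def halfProf (a b c μ x : ℝ) : ℝ :=
  if x ≤ c then cos (√b * μ * x) + √b / √a * sin (√b * μ * x)
  else √b / √a * sin (√b * μ * c) * exp (-(√a * μ * (x - c)))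

/-- The derivative of `halfProf`. -/
def halfProfD (a b c μ x : ℝ) : ℝ :=
  if x ≤ c then √b * μ * (-sin (√b * μ * x) + √b / √a * cos (√b * μ * x))
  else -(√b * μ) * sin (√b * μ * c) * exp (-(√a * μ * (x - c)))

variable {a b c μ : ℝ}

/-- Resonance removes the cosine term at `x = c`, leaving exactly the prefactor of the exponential.
-/
lemma continuous_halfProf (hres : cos (√b * μ * c) = 0) : Continuous (halfProf a b c μ) := by
  unfold halfProf
  refine Continuous.if_le (by fun_prop) (by fun_prop) continuous_id continuous_const fun x hx => ?_
  simp [hx, hres]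

/-- The slopes at `x = c` also match, again because the cosine vanishes. The coefficient `√b / √a`
of the sine in `halfProf` is the one for which the value and slope at `c` fit the decay rate `√a μ`.
-/
lemma continuous_halfProfD (hres : cos (√b * μ * c) = 0) : Continuous (halfProfD a b c μ) := by
  unfold halfProfD
  refine Continuous.if_le (by fun_prop) (by fun_prop) continuous_id continuous_const fun x hx => ?_
  simp [hx, hres]

lemma hasDerivAt_halfProf (ha : 0 < a) {x : ℝ} (hx : x ≠ c) :
    HasDerivAt (halfProf a b c μ) (halfProfD a b c μ x) x := by
  have ha' : √a ≠ 0 := (sqrt_pos.2 ha).ne'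
  rcases lt_or_gt_of_ne hx with h | h
  · have e : halfProf a b c μ =ᶠ[𝓝 x] fun x => cos (√b * μ * x) + √b / √a * sin (√b * μ * x) := by
      filter_upwards [Iio_mem_nhds h] with y hy
      rw [halfProf, if_pos (le_of_lt hy)]
    refine HasDerivAt.congr_of_eventuallyEq ?_ e
    rw [halfProfD, if_pos h.le]
    have d : HasDerivAt (fun x : ℝ => √b * μ * x) (√b * μ) x := by
      simpa using (hasDerivAt_id x).const_mul (√b * μ)
    refine (d.cos.add (d.sin.const_mul (√b / √a))).congr_deriv ?_
    ring
  · have e : halfProf a b c μ =ᶠ[𝓝 x]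
        fun x => √b / √a * sin (√b * μ * c) * exp (-(√a * μ * (x - c))) := by
      filter_upwards [Ioi_mem_nhds h] with y hy
      rw [halfProf, if_neg (not_le.2 hy)]
    refine HasDerivAt.congr_of_eventuallyEq ?_ e
    rw [halfProfD, if_neg (not_le.2 h)]
    have d : HasDerivAt (fun x : ℝ => -(√a * μ * (x - c))) (-(√a * μ)) x := by
      simpa using (((hasDerivAt_id x).sub_const c).const_mul (√a * μ)).fun_neg
    refine (d.exp.const_mul (√b / √a * sin (√b * μ * c))).congr_deriv ?_
    field_simp

lemma hasDerivAt_halfProfD (ha : 0 < a) (hb : 0 < b) {x : ℝ} (h0 : 0 < x) (hx : x ≠ c) :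
    HasDerivAt (halfProfD a b c μ)
      (-(μ ^ 2 * stepPotential a b c x * halfProf a b c μ x)) x := by
  have ha' : √a ≠ 0 := (sqrt_pos.2 ha).ne'
  have ha2 : √a ^ 2 = a := sq_sqrt ha.le
  have hb2 : √b ^ 2 = b := sq_sqrt hb.le
  rw [stepPotential, abs_of_pos h0]
  rcases lt_or_gt_of_ne hx with h | h
  · have e : halfProfD a b c μ =ᶠ[𝓝 x]
        fun x => √b * μ * (-sin (√b * μ * x) + √b / √a * cos (√b * μ * x)) := by
      filter_upwards [Iio_mem_nhds h] with y hy
      rw [halfProfD, if_pos (le_of_lt hy)]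
    refine HasDerivAt.congr_of_eventuallyEq ?_ e
    rw [halfProf, if_pos h.le, if_pos h]
    have d : HasDerivAt (fun x : ℝ => √b * μ * x) (√b * μ) x := by
      simpa using (hasDerivAt_id x).const_mul (√b * μ)
    refine ((d.sin.neg.add (d.cos.const_mul (√b / √a))).const_mul (√b * μ)).congr_deriv ?_
    linear_combination (-(μ ^ 2) * (cos (√b * μ * x) + √b / √a * sin (√b * μ * x))) * hb2
  · have e : halfProfD a b c μ =ᶠ[𝓝 x]
        fun x => -(√b * μ) * sin (√b * μ * c) * exp (-(√a * μ * (x - c))) := by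
      filter_upwards [Ioi_mem_nhds h] with y hy
      rw [halfProfD, if_neg (not_le.2 hy)]
    refine HasDerivAt.congr_of_eventuallyEq ?_ e
    rw [halfProf, if_neg (not_le.2 h), if_neg (not_lt.2 h.le)]
    have d : HasDerivAt (fun x : ℝ => -(√a * μ * (x - c))) (-(√a * μ)) x := by
      simpa using (((hasDerivAt_id x).sub_const c).const_mul (√a * μ)).fun_neg
    refine (d.exp.const_mul (-(√b * μ) * sin (√b * μ * c))).congr_deriv ?_
    have : a * (√b / √a) = √a * √b := by rw [← ha2]; field_simp; simp
    linear_combination (-(μ ^ 2) * sin (√b * μ * c) * exp (-(√a * μ * (x - c)))) * this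

lemma halfProf_zero (hc : 0 < c) : halfProf a b c μ 0 = 1 := by simp [halfProf, hc.le]

/-- The slope is proportional to the frequency. This is where resonance turns the
Dirichlet-to-Neumann map into a multiple of `|D|`. -/
lemma halfProfD_zero (hb : 0 < b) (hc : 0 < c) : halfProfD a b c μ 0 = b * μ / √a := by
  have hb2 : √b * √b = b := mul_self_sqrt hb.le
  simp only [halfProfD, hc.le, if_true, mul_zero, sin_zero, neg_zero, cos_zero, mul_one, zero_add]
  rw [mul_right_comm, ← mul_div_assoc, hb2]; ring

/-- The common constant in the exponential bounds for the profiles. -/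
def profConst (a b c Ω : ℝ) : ℝ := (1 + √b) * (1 + √b / √a) * exp (√a * Ω * c)

lemma profConst_pos : 0 < profConst a b c μ := by unfold profConst; positivity

/-- Constant and rate depend only on the lowest frequency `Ω`, so that one majorant serves all
modes. The factor `exp (√a Ω c)` in `profConst` compensates for the absence of decay inside the
well. -/
lemma abs_halfProf_le {Ω x : ℝ} (hΩ : 0 < Ω) (hμ : Ω ≤ μ) :
    |halfProf a b c μ x| ≤ profConst a b c Ω * exp (-(√a * Ω) * x) := by
  have e : profConst a b c Ω * exp (-(√a * Ω) * x) =
      (1 + √b) * (1 + √b / √a) * exp (-(√a * Ω * (x - c))) := by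
    rw [profConst, mul_assoc, ← exp_add]; ring_nf
  have h1 : (1 + √b / √a) ≤ (1 + √b) * (1 + √b / √a) :=
    le_mul_of_one_le_left (by positivity) (by linarith [sqrt_nonneg b])
  have hk : 0 ≤ √b / √a := by positivity
  rw [e, halfProf]
  split_ifs with h
  · have h2 : 1 ≤ exp (-(√a * Ω * (x - c))) := one_le_exp (by
      nlinarith [mul_nonneg (mul_nonneg (sqrt_nonneg a) hΩ.le) (sub_nonneg.2 h)])
    have h3 : |cos (√b * μ * x) + √b / √a * sin (√b * μ * x)| ≤ 1 + √b / √a := by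
      refine (abs_add_le _ _).trans (add_le_add (abs_cos_le_one _) ?_)
      rw [abs_mul, abs_of_nonneg hk]
      exact mul_le_of_le_one_right hk (abs_sin_le_one _)
    calc _ ≤ _ := h3
      _ ≤ _ := h1
      _ ≤ _ := le_mul_of_one_le_right (by positivity) h2
  · rw [abs_mul, abs_mul, abs_of_nonneg hk, abs_of_nonneg (exp_pos _).le]
    refine mul_le_mul ?_ ?_ (exp_pos _).le (by positivity)
    · refine le_trans (mul_le_of_le_one_right hk (abs_sin_le_one _)) (le_trans ?_ h1)
      linarith
    · refine exp_le_exp.2 (neg_le_neg ?_)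
      have : 0 ≤ x - c := by linarith
      gcongr

lemma abs_halfProfD_le {Ω x : ℝ} (hΩ : 0 < Ω) (hμ : Ω ≤ μ) :
    |halfProfD a b c μ x| ≤ profConst a b c Ω * μ * exp (-(√a * Ω) * x) := by
  have hμ0 : 0 < μ := hΩ.trans_le hμ
  have e : profConst a b c Ω * μ * exp (-(√a * Ω) * x) =
      (1 + √b) * μ * (1 + √b / √a) * exp (-(√a * Ω * (x - c))) := by
    have : exp (-(√a * Ω * (x - c))) = exp (√a * Ω * c) * exp (-(√a * Ω) * x) := by
      rw [← exp_add]; ring_nf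
    rw [profConst, this]; ring
  have hk : 0 ≤ √b / √a := by positivity
  have h1 : √b * μ ≤ (1 + √b) * μ := mul_le_mul_of_nonneg_right (by linarith) hμ0.le
  rw [e, halfProfD]
  split_ifs with h
  · have h2 : 1 ≤ exp (-(√a * Ω * (x - c))) := one_le_exp (by
      nlinarith [mul_nonneg (mul_nonneg (sqrt_nonneg a) hΩ.le) (sub_nonneg.2 h)])
    have h3 : |-sin (√b * μ * x) + √b / √a * cos (√b * μ * x)| ≤ 1 + √b / √a := by
      refine (abs_add_le _ _).trans (add_le_add (by rw [abs_neg]; exact abs_sin_le_one _) ?_)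
      rw [abs_mul, abs_of_nonneg hk]
      exact mul_le_of_le_one_right hk (abs_cos_le_one _)
    rw [abs_mul, abs_of_nonneg (by positivity : 0 ≤ √b * μ)]
    calc _ ≤ (1 + √b) * μ * (1 + √b / √a) := mul_le_mul h1 h3 (abs_nonneg _) (by positivity)
      _ ≤ _ := le_mul_of_one_le_right (by positivity) h2
  · rw [abs_mul, abs_mul, abs_neg, abs_of_nonneg (by positivity : 0 ≤ √b * μ),
      abs_of_nonneg (exp_pos _).le]
    refine mul_le_mul ?_ ?_ (exp_pos _).le (by positivity)
    · calc _ ≤ √b * μ := mul_le_of_le_one_right (by positivity) (abs_sin_le_one _)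
        _ ≤ (1 + √b) * μ := h1
        _ ≤ _ := le_mul_of_one_le_right (by positivity) (by linarith)
    · refine exp_le_exp.2 (neg_le_neg ?_)
      have : 0 ≤ x - c := by linarith
      gcongr

/-- The even extension of `halfProf`. -/
def prof (a b c μ x : ℝ) : ℝ := halfProf a b c μ |x|

/-- The derivative of `prof` away from the origin. -/
def profD (a b c μ x : ℝ) : ℝ := if 0 < x then halfProfD a b c μ x else -halfProfD a b c μ (-x)

lemma prof_of_pos {x : ℝ} (hx : 0 < x) : prof a b c μ x = halfProf a b c μ x := by
  rw [prof, abs_of_pos hx]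

lemma prof_neg (x : ℝ) : prof a b c μ (-x) = prof a b c μ x := by rw [prof, prof, abs_neg]

lemma profD_of_pos {x : ℝ} (hx : 0 < x) : profD a b c μ x = halfProfD a b c μ x := if_pos hx

lemma profD_neg_of_pos {x : ℝ} (hx : 0 < x) : profD a b c μ (-x) = -halfProfD a b c μ x := by
  rw [profD, if_neg (by linarith), neg_neg]

lemma abs_prof_le {Ω x : ℝ} (hΩ : 0 < Ω) (hμ : Ω ≤ μ) :
    |prof a b c μ x| ≤ profConst a b c Ω * exp (-(√a * Ω) * |x|) := abs_halfProf_le hΩ hμ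

lemma abs_profD_le {Ω x : ℝ} (hΩ : 0 < Ω) (hμ : Ω ≤ μ) :
    |profD a b c μ x| ≤ profConst a b c Ω * μ * exp (-(√a * Ω) * |x|) := by
  unfold profD
  split_ifs with h
  · rw [abs_of_pos h]; exact abs_halfProfD_le hΩ hμ
  · rw [abs_of_nonpos (not_lt.1 h), abs_neg]; exact abs_halfProfD_le hΩ hμ

lemma continuous_prof (hres : cos (√b * μ * c) = 0) : Continuous (prof a b c μ) :=
  (continuous_halfProf hres).comp continuous_abs

lemma measurable_profD (hres : cos (√b * μ * c) = 0) : Measurable (profD a b c μ) :=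
  Measurable.ite measurableSet_Ioi (continuous_halfProfD hres).measurable
    ((continuous_halfProfD hres).measurable.comp measurable_neg).neg

lemma prof_zero (hc : 0 < c) : prof a b c μ 0 = 1 := by rw [prof, abs_zero, halfProf_zero hc]

/-! ### Integration by parts -/

lemma measurable_stepPotential : Measurable (stepPotential a b c) :=
  Measurable.ite (measurableSet_lt (by fun_prop) measurable_const) measurable_const measurable_const

lemma abs_stepPotential_le (x : ℝ) : |stepPotential a b c x| ≤ |a| + |b| := by
  unfold stepPotential; split_ifs
  · linarith [abs_nonneg a]
  · rw [abs_neg]; linarith [abs_nonneg b]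

lemma stepPotential_neg (x : ℝ) : stepPotential a b c (-x) = stepPotential a b c x := by
  rw [stepPotential, stepPotential, abs_neg]

lemma intervalIntegrable_stepPotential (u v : ℝ) :
    IntervalIntegrable (stepPotential a b c) volume u v :=
  (intervalIntegrable_const (c := |a| + |b|)).mono_fun measurable_stepPotential.aestronglyMeasurable
    (.of_forall fun t => by
      simpa only [norm_eq_abs] using (abs_stepPotential_le t).trans (le_abs_self _))

/-- The fundamental theorem of calculus with one exceptional point: at the interface `c`
differentiability is not required, only continuity. -/
lemma setIntegral_Ioi_of_hasDerivAt {F f : ℝ → ℝ} {R : ℝ} (hR : 0 ≤ R) (hF : Continuous F)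
    (hd : ∀ x, 0 < x → x ≠ c → HasDerivAt F (f x) x) (hi : IntervalIntegrable f volume 0 R)
    (hFR : F R = 0) (hfR : ∀ x, R < x → f x = 0) : ∫ x in Ioi 0, f x = -F 0 := by
  have h := integral_eq_of_hasDerivAt_off_countable_of_le F f hR (countable_singleton c)
    hF.continuousOn (fun x hx => hd x hx.1.1 hx.2) hi
  rw [hFR, zero_sub, intervalIntegral.integral_of_le hR] at h
  rw [← h, setIntegral_eq_of_subset_of_forall_sdiff_eq_zero measurableSet_Ioi
    Ioc_subset_Ioi_self]
  rintro x ⟨hx, hx'⟩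
  exact hfR x (by by_contra hle; exact hx' ⟨hx, not_lt.1 hle⟩)

lemma integral_halfProf_parts (ha : 0 < a) (hc : 0 < c) (hres : cos (√b * μ * c) = 0) {χ χ' : ℝ → ℝ}
    (hχ : ∀ x, HasDerivAt χ (χ' x) x) (hχ' : Continuous χ') {R : ℝ} (hR : 0 ≤ R)
    (h0 : ∀ x, R ≤ x → χ x = 0) (h0' : ∀ x, R ≤ x → χ' x = 0) :
    ∫ x in Ioi 0, (halfProf a b c μ x * χ' x + halfProfD a b c μ x * χ x) = -χ 0 := by
  have hχc : Continuous χ := continuous_iff_continuousAt.2 fun x => (hχ x).continuousAt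
  have hP := continuous_halfProf (a := a) hres
  have hQ := continuous_halfProfD (a := a) hres
  rw [setIntegral_Ioi_of_hasDerivAt (c := c) (F := fun x => halfProf a b c μ x * χ x) hR
    (hP.mul hχc)
    (fun x _ hx => ((hasDerivAt_halfProf ha hx).mul (hχ x)).congr_deriv (add_comm _ _))
    (Continuous.intervalIntegrable (by fun_prop) _ _) (by simp [h0 R le_rfl])
    (fun x hx => by simp [h0 x hx.le, h0' x hx.le]), halfProf_zero hc, one_mul]

lemma integral_halfProfD_parts (ha : 0 < a) (hb : 0 < b) (hc : 0 < c) (hres : cos (√b * μ * c) = 0)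
    {χ χ' : ℝ → ℝ}
    (hχ : ∀ x, HasDerivAt χ (χ' x) x) (hχ' : Continuous χ') {R : ℝ} (hR : 0 ≤ R)
    (h0 : ∀ x, R ≤ x → χ x = 0) (h0' : ∀ x, R ≤ x → χ' x = 0) :
    ∫ x in Ioi 0, (halfProfD a b c μ x * χ' x -
      μ ^ 2 * stepPotential a b c x * halfProf a b c μ x * χ x) = -(b * μ / √a * χ 0) := by
  have hχc : Continuous χ := continuous_iff_continuousAt.2 fun x => (hχ x).continuousAt
  have hP := continuous_halfProf (a := a) hres
  have hQ := continuous_halfProfD (a := a) hres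
  rw [setIntegral_Ioi_of_hasDerivAt (c := c) (F := fun x => halfProfD a b c μ x * χ x) hR
    (hQ.mul hχc)
    (fun x h hx => ((hasDerivAt_halfProfD ha hb h hx).mul (hχ x)).congr_deriv (by ring))
    ((Continuous.intervalIntegrable (by fun_prop) _ _).sub ?_) (by simp [h0 R le_rfl])
    (fun x hx => by simp [h0 x hx.le, h0' x hx.le]), halfProfD_zero hb hc]
  exact (((intervalIntegrable_stepPotential 0 R).const_mul _).mul_continuousOn
    hP.continuousOn).mul_continuousOn hχc.continuousOn

lemma integral_eq_add_neg {h : ℝ → ℝ} (hi : Integrable h) :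
    ∫ x, h x = (∫ x in Ioi 0, h x) + ∫ x in Ioi 0, h (-x) := by
  rw [integral_comp_neg_Ioi, neg_zero, add_comm, intervalIntegral.integral_Iic_add_Ioi hi.integrableOn
    hi.integrableOn]

/-- The even profile is continuous at the origin, so the boundary terms of the two half lines
cancel. -/
lemma integral_prof_parts (ha : 0 < a) (hc : 0 < c) (hres : cos (√b * μ * c) = 0) {χ χ' : ℝ → ℝ}
    (hχ : ∀ x, HasDerivAt χ (χ' x) x) (hχ' : Continuous χ') {R : ℝ} (hR : 0 ≤ R)
    (h0 : ∀ x, R ≤ |x| → χ x = 0) (h0' : ∀ x, R ≤ |x| → χ' x = 0)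
    (hi : Integrable fun x => prof a b c μ x * χ' x + profD a b c μ x * χ x) :
    ∫ x, (prof a b c μ x * χ' x + profD a b c μ x * χ x) = 0 := by
  rw [integral_eq_add_neg hi]
  have e1 : ∫ x in Ioi 0, (prof a b c μ x * χ' x + profD a b c μ x * χ x) = -χ 0 := by
    rw [← integral_halfProf_parts ha hc hres hχ hχ' hR (fun x hx => h0 x (hx.trans (le_abs_self x)))
      (fun x hx => h0' x (hx.trans (le_abs_self x)))]
    exact setIntegral_congr_fun measurableSet_Ioi fun x hx => by
      simp only [prof_of_pos (mem_Ioi.1 hx), profD_of_pos (mem_Ioi.1 hx)]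
  have e2 : ∫ x in Ioi 0, (prof a b c μ (-x) * χ' (-x) + profD a b c μ (-x) * χ (-x)) = χ 0 := by
    have := integral_halfProf_parts (χ := fun x => χ (-x)) (χ' := fun x => -χ' (-x)) ha hc hres
      (fun x => ((hχ (-x)).comp x (hasDerivAt_neg x)).congr_deriv (by ring)) (by fun_prop) hR
      (fun x hx => h0 _ (by rw [abs_neg]; exact hx.trans (le_abs_self x)))
      (fun x hx => by
        simp only [neg_eq_zero]; exact h0' _ (by rw [abs_neg]; exact hx.trans (le_abs_self x)))
    rw [neg_zero, ← neg_eq_iff_eq_neg, ← integral_neg] at this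
    rw [← this]
    exact setIntegral_congr_fun measurableSet_Ioi fun x hx => by
      simp only [prof_neg, prof_of_pos (mem_Ioi.1 hx), profD_neg_of_pos (mem_Ioi.1 hx)]; ring
  rw [e1, e2]; ring

/-- The derivative of the even profile is odd, so here the boundary terms add up: its jump `2 b μ /
√a` at the origin appears as a point mass. -/
lemma integral_profD_parts (ha : 0 < a) (hb : 0 < b) (hc : 0 < c) (hres : cos (√b * μ * c) = 0)
    {χ χ' : ℝ → ℝ}
    (hχ : ∀ x, HasDerivAt χ (χ' x) x) (hχ' : Continuous χ') {R : ℝ} (hR : 0 ≤ R)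
    (h0 : ∀ x, R ≤ |x| → χ x = 0) (h0' : ∀ x, R ≤ |x| → χ' x = 0)
    (hi : Integrable fun x => profD a b c μ x * χ' x -
      μ ^ 2 * stepPotential a b c x * prof a b c μ x * χ x) :
    ∫ x, (profD a b c μ x * χ' x - μ ^ 2 * stepPotential a b c x * prof a b c μ x * χ x) =
      -(2 * (b * μ / √a) * χ 0) := by
  rw [integral_eq_add_neg hi]
  have e1 : ∫ x in Ioi 0, (profD a b c μ x * χ' x -
      μ ^ 2 * stepPotential a b c x * prof a b c μ x * χ x) = -(b * μ / √a * χ 0) := by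
    rw [← integral_halfProfD_parts ha hb hc hres hχ hχ' hR
      (fun x hx => h0 x (hx.trans (le_abs_self x)))
      (fun x hx => h0' x (hx.trans (le_abs_self x)))]
    exact setIntegral_congr_fun measurableSet_Ioi fun x hx => by
      simp only [prof_of_pos (mem_Ioi.1 hx), profD_of_pos (mem_Ioi.1 hx)]
  have e2 : ∫ x in Ioi 0, (profD a b c μ (-x) * χ' (-x) -
      μ ^ 2 * stepPotential a b c (-x) * prof a b c μ (-x) * χ (-x)) = -(b * μ / √a * χ 0) := by
    have := integral_halfProfD_parts (χ := fun x => χ (-x)) (χ' := fun x => -χ' (-x)) ha hb hc hres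
      (fun x => ((hχ (-x)).comp x (hasDerivAt_neg x)).congr_deriv (by ring)) (by fun_prop) hR
      (fun x hx => h0 _ (by rw [abs_neg]; exact hx.trans (le_abs_self x)))
      (fun x hx => by
        simp only [neg_eq_zero]; exact h0' _ (by rw [abs_neg]; exact hx.trans (le_abs_self x)))
    rw [neg_zero] at this
    rw [← this]
    exact setIntegral_congr_fun measurableSet_Ioi fun x hx => by
      simp only [prof_neg, prof_of_pos (mem_Ioi.1 hx), profD_neg_of_pos (mem_Ioi.1 hx),
        stepPotential_neg]; ring
  rw [e1, e2]; ring

end Breather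
end

noncomputable section
namespace Breather
open Real Set Filter Topology

/-! ### The cylinder and test functions -/

lemma cylMeasure_eq_prod (T : ℝ) : cylMeasure T = (volume : Measure ℝ).prod (torusMeasure T) := by
  rw [cylMeasure, torusMeasure, Measure.volume_eq_prod, ← Measure.prod_restrict,
    Measure.restrict_univ]

lemma halfCylMeasure_eq_prod (T : ℝ) :
    halfCylMeasure T = ((volume : Measure ℝ).restrict (Ioi 0)).prod (torusMeasure T) := by
  rw [halfCylMeasure, torusMeasure, Measure.volume_eq_prod, ← Measure.prod_restrict]

lemma halfCylMeasure_eq_restrict (T : ℝ) :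
    halfCylMeasure T = (cylMeasure T).restrict {p | 0 < p.1} := by
  rw [halfCylMeasure, cylMeasure, Measure.restrict_restrict
    (measurableSet_lt measurable_const measurable_fst)]
  congr 1; ext p; simp

instance (T : ℝ) : IsFiniteMeasure (torusMeasure T) := by unfold torusMeasure; infer_instance

instance (T : ℝ) : SFinite (cylMeasure T) := by rw [cylMeasure_eq_prod]; infer_instance

lemma integral_torusMeasure {T : ℝ} (hT : 0 ≤ T) (f : ℝ → ℝ) :
    ∫ t, f t ∂torusMeasure T = ∫ t in (0)..T, f t := (intervalIntegral.integral_of_le hT).symm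

lemma ae_cylMeasure_mem (T : ℝ) : ∀ᵐ p ∂cylMeasure T, p.2 ∈ Ioc 0 T := by
  refine (ae_restrict_iff' (MeasurableSet.univ.prod measurableSet_Ioc)).2 (.of_forall fun p hp => hp.2)

lemma integrable_exp_neg_mul_abs {ρ : ℝ} (hρ : 0 < ρ) : Integrable fun x : ℝ => exp (-ρ * |x|) := by
  rw [← integrableOn_univ, ← Iic_union_Ioi (a := (0 : ℝ)), integrableOn_union]
  constructor
  · refine (integrableOn_exp_mul_Iic hρ 0).congr_fun (fun x hx => ?_) measurableSet_Iic
    simp only [abs_of_nonpos (mem_Iic.1 hx), neg_mul_neg]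
  · refine (exp_neg_integrableOn_Ioi 0 hρ).congr_fun (fun x hx => ?_) measurableSet_Ioi
    simp only [abs_of_pos (mem_Ioi.1 hx)]

lemma integrable_cyl_exp {ρ : ℝ} (hρ : 0 < ρ) (T : ℝ) :
    Integrable (fun p : ℝ × ℝ => exp (-ρ * |p.1|)) (cylMeasure T) := by
  rw [cylMeasure_eq_prod]
  exact (integrable_exp_neg_mul_abs hρ).comp_fst _

lemma memLp_cyl_exp {ρ : ℝ} (hρ : 0 < ρ) (T C : ℝ) :
    MemLp (fun p : ℝ × ℝ => C * exp (-ρ * |p.1|)) 2 (cylMeasure T) := by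
  refine MemLp.const_mul ?_ C
  rw [memLp_two_iff_integrable_sq (by fun_prop)]
  refine (integrable_cyl_exp (by linarith : 0 < 2 * ρ) T).congr (.of_forall fun p => ?_)
  simp only [sq, ← exp_add]; ring_nf

lemma memLp_cyl_of_exp_bound {f : ℝ × ℝ → ℝ} (hf : Measurable f) {T C ρ : ℝ} (hρ : 0 < ρ)
    (hb : ∀ p : ℝ × ℝ, p.2 ∈ Ioc 0 T → |f p| ≤ C * exp (-ρ * |p.1|)) : MemLp f 2 (cylMeasure T) := by
  refine (memLp_cyl_exp hρ T C).mono hf.aestronglyMeasurable ?_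
  filter_upwards [ae_cylMeasure_mem T] with p hp
  exact (hb p hp).trans (le_abs_self _)

lemma memLp_cyl_of_support {f : ℝ × ℝ → ℝ} (hf : Continuous f) {R : ℝ}
    (hR : ∀ x t, R < |x| → f (x, t) = 0) (T : ℝ) : MemLp f 2 (cylMeasure T) := by
  obtain ⟨C, hC⟩ := (isCompact_Icc.prod isCompact_Icc).exists_bound_of_continuousOn
    (s := Icc (-R) R ×ˢ Icc 0 T) hf.continuousOn
  refine memLp_cyl_of_exp_bound hf.measurable one_pos (C := |C| * exp R) fun p hp => ?_
  by_cases h : R < |p.1|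
  · rw [show f p = 0 from hR p.1 p.2 h, abs_zero]; positivity
  · have h1 := hC p ⟨abs_le.1 (not_lt.1 h), Ioc_subset_Icc_self hp⟩
    rw [mul_assoc, ← exp_add]
    calc |f p| ≤ |C| * 1 := by rw [mul_one]; exact h1.trans (le_abs_self C)
      _ ≤ _ := mul_le_mul_of_nonneg_left (one_le_exp (by linarith [not_lt.1 h])) (abs_nonneg C)

variable {T : ℝ} {ψ : ℝ × ℝ → ℝ}

lemma IsTest.differentiable (h : IsTest T ψ) : Differentiable ℝ ψ := h.smooth.differentiable (by simp)

lemma IsTest.hasDerivAt_x (h : IsTest T ψ) (x t : ℝ) :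
    HasDerivAt (fun y => ψ (y, t)) (dx ψ (x, t)) x := by
  have : DifferentiableAt ℝ (fun y => ψ (y, t)) x :=
    (h.differentiable (x, t)).comp x (by fun_prop : DifferentiableAt ℝ (fun y : ℝ => (y, t)) x)
  exact this.hasDerivAt

lemma IsTest.hasDerivAt_t (h : IsTest T ψ) (x t : ℝ) :
    HasDerivAt (fun s => ψ (x, s)) (dt ψ (x, t)) t := by
  have : DifferentiableAt ℝ (fun s => ψ (x, s)) t :=
    (h.differentiable (x, t)).comp t (by fun_prop : DifferentiableAt ℝ (fun s : ℝ => (x, s)) t)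
  exact this.hasDerivAt

lemma IsTest.continuous (h : IsTest T ψ) : Continuous ψ := h.smooth.continuous

lemma IsTest.continuous_fderiv (h : IsTest T ψ) : Continuous (fderiv ℝ ψ) :=
  h.smooth.continuous_fderiv (by simp)

lemma IsTest.continuous_dx (h : IsTest T ψ) : Continuous (dx ψ) := by
  have e : dx ψ = fun p => fderiv ℝ ψ p (1, 0) := funext fun p => by
    have h1 : HasDerivAt (fun y : ℝ => (y, p.2)) ((1 : ℝ), (0 : ℝ)) p.1 :=
      (hasDerivAt_id p.1).prodMk (hasDerivAt_const p.1 p.2)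
    exact ((h.differentiable p).hasFDerivAt.comp_hasDerivAt p.1 h1).deriv
  rw [e]; exact h.continuous_fderiv.clm_apply continuous_const

lemma IsTest.continuous_dt (h : IsTest T ψ) : Continuous (dt ψ) := by
  have e : dt ψ = fun p => fderiv ℝ ψ p (0, 1) := funext fun p => by
    have h1 : HasDerivAt (fun y : ℝ => (p.1, y)) ((0 : ℝ), (1 : ℝ)) p.2 :=
      (hasDerivAt_const p.2 p.1).prodMk (hasDerivAt_id p.2)
    exact ((h.differentiable p).hasFDerivAt.comp_hasDerivAt p.2 h1).deriv
  rw [e]; exact h.continuous_fderiv.clm_apply continuous_const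

lemma IsTest.exists_support (h : IsTest T ψ) : ∃ R, 0 ≤ R ∧ ∀ x t : ℝ, R < |x| →
    ψ (x, t) = 0 ∧ dx ψ (x, t) = 0 ∧ dt ψ (x, t) = 0 := by
  obtain ⟨R, hR⟩ := h.support
  refine ⟨max R 0, le_max_right _ _, fun x t hx => ?_⟩
  have hx' : R < |x| := (le_max_left _ _).trans_lt hx
  refine ⟨hR x t hx', ?_, ?_⟩
  · have : (fun y => ψ (y, t)) =ᶠ[𝓝 x] fun _ => 0 := by
      filter_upwards [(isOpen_lt continuous_const continuous_abs).mem_nhds hx'] with y hy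
      exact hR y t hy
    rw [dx, this.deriv_eq, deriv_const]
  · have : (fun s => ψ (x, s)) = fun _ => 0 := funext fun s => hR x s hx'
    rw [dt]; simp only [this, deriv_const]

lemma IsTest.memLp (h : IsTest T ψ) : MemLp ψ 2 (cylMeasure T) := by
  obtain ⟨R, _, hR⟩ := h.exists_support
  exact memLp_cyl_of_support h.continuous (fun x t hx => (hR x t hx).1) T

lemma IsTest.memLp_dx (h : IsTest T ψ) : MemLp (dx ψ) 2 (cylMeasure T) := by
  obtain ⟨R, _, hR⟩ := h.exists_support
  exact memLp_cyl_of_support h.continuous_dx (fun x t hx => (hR x t hx).2.1) T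

lemma IsTest.memLp_dt (h : IsTest T ψ) : MemLp (dt ψ) 2 (cylMeasure T) := by
  obtain ⟨R, _, hR⟩ := h.exists_support
  exact memLp_cyl_of_support h.continuous_dt (fun x t hx => (hR x t hx).2.2) T

/-! ### Single modes -/

variable {μ : ℝ}

/-- Frequencies of `T`-periodic functions. -/
def IsFreq (T μ : ℝ) : Prop := ∃ k : ℕ, μ * T = k * (2 * π)

lemma IsFreq.cos_eq (h : IsFreq T μ) : cos (μ * T) = 1 := by
  obtain ⟨k, hk⟩ := h; rw [hk, cos_nat_mul_two_pi]

lemma IsFreq.sin_eq (h : IsFreq T μ) : sin (μ * T) = 0 := by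
  obtain ⟨k, hk⟩ := h
  rw [hk, show (k : ℝ) * (2 * π) = ((2 * k : ℕ) : ℝ) * π by push_cast; ring, sin_nat_mul_pi]

lemma integral_cos_mul_deriv (hμ : IsFreq T μ) {η η' : ℝ → ℝ} (hη : ∀ t, HasDerivAt η (η' t) t)
    (hη' : Continuous η') (hT : η T = η 0) :
    ∫ t in (0)..T, cos (μ * t) * η' t = μ * ∫ t in (0)..T, sin (μ * t) * η t := by
  have h := intervalIntegral.integral_mul_deriv_eq_deriv_mul (a := 0) (b := T)
    (u := fun t => cos (μ * t)) (u' := fun t => -sin (μ * t) * μ)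
    (fun t _ => by simpa using ((hasDerivAt_id t).const_mul μ).cos) (fun t _ => hη t)
    (Continuous.intervalIntegrable (by fun_prop) _ _) (hη'.intervalIntegrable _ _)
  rw [h, hμ.cos_eq, hT, ← intervalIntegral.integral_const_mul]
  simp only [mul_zero, cos_zero, sub_self, zero_sub, ← intervalIntegral.integral_neg]
  congr 1; ext t; ring

/-- Unlike the cosine version, this needs no periodicity of `η`: the sine vanishes at both ends. -/
lemma integral_sin_mul_deriv (hμ : IsFreq T μ) {η η' : ℝ → ℝ} (hη : ∀ t, HasDerivAt η (η' t) t)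
    (hη' : Continuous η') :
    ∫ t in (0)..T, sin (μ * t) * η' t = -(μ * ∫ t in (0)..T, cos (μ * t) * η t) := by
  have h := intervalIntegral.integral_mul_deriv_eq_deriv_mul (a := 0) (b := T)
    (u := fun t => sin (μ * t)) (u' := fun t => cos (μ * t) * μ)
    (fun t _ => by simpa using ((hasDerivAt_id t).const_mul μ).sin) (fun t _ => hη t)
    (Continuous.intervalIntegrable (by fun_prop) _ _) (hη'.intervalIntegrable _ _)
  rw [h, hμ.sin_eq, ← intervalIntegral.integral_const_mul]
  simp only [mul_zero, sin_zero, zero_mul, sub_self, zero_sub]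
  congr 2; ext t; ring

variable {h : ℝ → ℝ} {C ρ : ℝ}

lemma memLp_separated (hm : Measurable h) (hb : ∀ x, |h x| ≤ C * exp (-ρ * |x|)) (hρ : 0 < ρ)
    {k : ℝ → ℝ} (hk : Measurable k) (hk1 : ∀ t, |k t| ≤ 1) :
    MemLp (fun p : ℝ × ℝ => h p.1 * k p.2) 2 (cylMeasure T) := by
  refine memLp_cyl_of_exp_bound (by fun_prop) hρ (C := C) fun p _ => ?_
  rw [abs_mul]
  exact (mul_le_of_le_one_right (abs_nonneg _) (hk1 _)).trans (hb _)

lemma integral_separated_cos_dt (hψ : IsTest T ψ) (hT : 0 < T) (hμ : IsFreq T μ) (hm : Measurable h)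
    (hb : ∀ x, |h x| ≤ C * exp (-ρ * |x|)) (hρ : 0 < ρ) :
    ∫ p, h p.1 * cos (μ * p.2) * dt ψ p ∂cylMeasure T =
      μ * ∫ p, h p.1 * sin (μ * p.2) * ψ p ∂cylMeasure T := by
  have h1 := (memLp_separated (T := T) hm hb hρ (k := fun t => cos (μ * t)) (by fun_prop)
    fun t => abs_cos_le_one _).integrable_mul hψ.memLp_dt
  have h2 := (memLp_separated (T := T) hm hb hρ (k := fun t => sin (μ * t)) (by fun_prop)
    fun t => abs_sin_le_one _).integrable_mul hψ.memLp
  simp only [cylMeasure_eq_prod] at *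
  erw [integral_prod _ h1, integral_prod _ h2]
  rw [← integral_const_mul]
  congr 1; ext x
  simp only [Pi.mul_apply, mul_assoc, intervalIntegral.integral_const_mul, integral_torusMeasure hT.le]
  rw [integral_cos_mul_deriv hμ (hψ.hasDerivAt_t x) (hψ.continuous_dt.comp (by fun_prop))
    (by simpa using hψ.periodic x 0)]
  ring

lemma integral_separated_sin_dt (hψ : IsTest T ψ) (hT : 0 < T) (hμ : IsFreq T μ) (hm : Measurable h)
    (hb : ∀ x, |h x| ≤ C * exp (-ρ * |x|)) (hρ : 0 < ρ) :
    ∫ p, h p.1 * sin (μ * p.2) * dt ψ p ∂cylMeasure T =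
      -(μ * ∫ p, h p.1 * cos (μ * p.2) * ψ p ∂cylMeasure T) := by
  have h1 := (memLp_separated (T := T) hm hb hρ (k := fun t => sin (μ * t)) (by fun_prop)
    fun t => abs_sin_le_one _).integrable_mul hψ.memLp_dt
  have h2 := (memLp_separated (T := T) hm hb hρ (k := fun t => cos (μ * t)) (by fun_prop)
    fun t => abs_cos_le_one _).integrable_mul hψ.memLp
  simp only [cylMeasure_eq_prod] at *
  erw [integral_prod _ h1, integral_prod _ h2]
  rw [← integral_const_mul, ← integral_neg]
  congr 1; ext x
  simp only [Pi.mul_apply, mul_assoc, intervalIntegral.integral_const_mul, integral_torusMeasure hT.le]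
  rw [integral_sin_mul_deriv hμ (hψ.hasDerivAt_t x) (hψ.continuous_dt.comp (by fun_prop))]
  ring

end Breather
end

noncomputable section
namespace Breather
open Real Set Filter Topology

variable {T : ℝ} {ψ : ℝ × ℝ → ℝ} {a b c Ω μ : ℝ}

/-- The time-harmonic solution with frequency `μ`. -/
def modeW (a b c μ : ℝ) (p : ℝ × ℝ) : ℝ := prof a b c μ p.1 * cos (μ * p.2)

/-- The `x`-derivative of `modeW`. -/
def modeX (a b c μ : ℝ) (p : ℝ × ℝ) : ℝ := profD a b c μ p.1 * cos (μ * p.2)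

/-- The `t`-derivative of `modeW`. -/
def modeT (a b c μ : ℝ) (p : ℝ × ℝ) : ℝ := -(μ * (prof a b c μ p.1 * sin (μ * p.2)))

/-- Admissible frequencies: at least `Ω`, `T`-periodic, and in resonance with the well `|x| < c`. -/
structure IsModeFreq (T b c Ω μ : ℝ) : Prop where
  le : Ω ≤ μ
  freq : IsFreq T μ
  res : cos (√b * μ * c) = 0

lemma decay_pos (ha : 0 < a) (hΩ : 0 < Ω) : 0 < √a * Ω := mul_pos (sqrt_pos.2 ha) hΩ

namespace IsModeFreq

variable (h : IsModeFreq T b c Ω μ)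
include h

lemma measurable_prof : Measurable (prof a b c μ) := (continuous_prof h.res).measurable

lemma measurable_modeW : Measurable (modeW a b c μ) :=
  (h.measurable_prof.comp measurable_fst).mul (by fun_prop)

lemma abs_modeW_le (hΩ : 0 < Ω) (p : ℝ × ℝ) :
    |modeW a b c μ p| ≤ profConst a b c Ω * exp (-(√a * Ω) * |p.1|) := by
  rw [modeW, abs_mul]
  exact (mul_le_of_le_one_right (abs_nonneg _) (abs_cos_le_one _)).trans (abs_prof_le hΩ h.le)

lemma memLp_modeW (ha : 0 < a) (hΩ : 0 < Ω) : MemLp (modeW a b c μ) 2 (cylMeasure T) :=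
  memLp_cyl_of_exp_bound h.measurable_modeW (decay_pos ha hΩ) fun p _ => h.abs_modeW_le hΩ p

lemma measurable_modeX : Measurable (modeX a b c μ) :=
  ((measurable_profD h.res).comp measurable_fst).mul (by fun_prop)

lemma abs_modeX_le (hΩ : 0 < Ω) (p : ℝ × ℝ) :
    |modeX a b c μ p| ≤ profConst a b c Ω * μ * exp (-(√a * Ω) * |p.1|) := by
  rw [modeX, abs_mul]
  exact (mul_le_of_le_one_right (abs_nonneg _) (abs_cos_le_one _)).trans (abs_profD_le hΩ h.le)

lemma memLp_modeX (ha : 0 < a) (hΩ : 0 < Ω) : MemLp (modeX a b c μ) 2 (cylMeasure T) :=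
  memLp_cyl_of_exp_bound h.measurable_modeX (decay_pos ha hΩ) fun p _ => h.abs_modeX_le hΩ p

lemma measurable_modeT : Measurable (modeT a b c μ) :=
  (measurable_const.mul ((h.measurable_prof.comp measurable_fst).mul (by fun_prop))).neg

lemma abs_modeT_le (hΩ : 0 < Ω) (p : ℝ × ℝ) :
    |modeT a b c μ p| ≤ profConst a b c Ω * μ * exp (-(√a * Ω) * |p.1|) := by
  have hμ : 0 ≤ μ := hΩ.le.trans h.le
  rw [modeT, abs_neg, abs_mul, abs_mul, abs_of_nonneg hμ, mul_comm _ μ, mul_assoc]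
  exact mul_le_mul_of_nonneg_left ((mul_le_of_le_one_right (abs_nonneg _) (abs_sin_le_one _)).trans
    (abs_prof_le hΩ h.le)) hμ

lemma memLp_profD_fst (ha : 0 < a) (hΩ : 0 < Ω) :
    MemLp (fun p : ℝ × ℝ => profD a b c μ p.1) 2 (cylMeasure T) :=
  memLp_cyl_of_exp_bound ((measurable_profD h.res).comp measurable_fst) (decay_pos ha hΩ)
    fun _ _ => abs_profD_le hΩ h.le

lemma memLp_prof_fst (ha : 0 < a) (hΩ : 0 < Ω) :
    MemLp (fun p : ℝ × ℝ => prof a b c μ p.1) 2 (cylMeasure T) :=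
  memLp_cyl_of_exp_bound (h.measurable_prof.comp measurable_fst) (decay_pos ha hΩ)
    fun _ _ => abs_prof_le hΩ h.le

lemma integral_modeW_dx (hψ : IsTest T ψ) (ha : 0 < a) (hc : 0 < c) (hΩ : 0 < Ω) :
    ∫ p, modeW a b c μ p * dx ψ p ∂cylMeasure T = -∫ p, modeX a b c μ p * ψ p ∂cylMeasure T := by
  have i1 := (h.memLp_modeW (a := a) ha hΩ).integrable_mul hψ.memLp_dx
  have i2 := (h.memLp_modeX (a := a) ha hΩ).integrable_mul hψ.memLp
  rw [eq_neg_iff_add_eq_zero]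
  refine (integral_add i1 i2).symm.trans ?_
  have i3 := i1.add i2
  -- The cosine factor is dropped here: integrability of the full product would say nothing on
  -- slices where the cosine vanishes, whereas this gives the integrability that
  -- `integral_prof_parts` needs for almost every `t`.
  have i4 := ((h.memLp_prof_fst (a := a) ha hΩ).integrable_mul hψ.memLp_dx).add
    ((h.memLp_profD_fst (a := a) ha hΩ).integrable_mul hψ.memLp)
  obtain ⟨R, hR, hs⟩ := hψ.exists_support
  rw [cylMeasure_eq_prod] at *
  refine (integral_prod_symm _ i3).trans (integral_eq_zero_of_ae ?_)
  filter_upwards [i4.prod_left_ae] with t ht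
  have := integral_prof_parts ha hc h.res (fun x => hψ.hasDerivAt_x x t)
    (hψ.continuous_dx.comp (by fun_prop)) (by positivity : 0 ≤ R + 1)
    (fun x hx => (hs x t (by linarith)).1) (fun x hx => (hs x t (by linarith)).2.1) ht
  have e : ∀ x, ((modeW a b c μ * dx ψ) + (modeX a b c μ * ψ)) (x, t) =
      cos (μ * t) * (prof a b c μ x * dx ψ (x, t) + profD a b c μ x * ψ (x, t)) := fun x => by
    simp only [Pi.add_apply, Pi.mul_apply, modeW, modeX]; ring
  simp only [e, integral_const_mul, this, mul_zero, Pi.zero_apply]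

lemma integral_modeW_dt (hψ : IsTest T ψ) (ha : 0 < a) (hT : 0 < T) (hΩ : 0 < Ω) :
    ∫ p, modeW a b c μ p * dt ψ p ∂cylMeasure T = -∫ p, modeT a b c μ p * ψ p ∂cylMeasure T := by
  simp only [modeW, modeT, neg_mul, integral_neg, neg_neg, mul_assoc μ, integral_const_mul]
  exact integral_separated_cos_dt hψ hT h.freq h.measurable_prof (fun x => abs_prof_le hΩ h.le)
    (decay_pos ha hΩ)

lemma integral_half_mode (hψ : IsTest T ψ) (ha : 0 < a) (hc : 0 < c) (hΩ : 0 < Ω) :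
    ∫ p, (modeW a b c μ p * dx ψ p + modeX a b c μ p * ψ p) ∂halfCylMeasure T =
      -∫ t, cos (μ * t) * ψ (0, t) ∂torusMeasure T := by
  have i1 := (h.memLp_modeW (a := a) ha hΩ).integrable_mul hψ.memLp_dx
  have i2 := (h.memLp_modeX (a := a) ha hΩ).integrable_mul hψ.memLp
  have i3 : Integrable (fun p => modeW a b c μ p * dx ψ p + modeX a b c μ p * ψ p)
      (halfCylMeasure T) := by
    rw [halfCylMeasure_eq_restrict]; exact (i1.add i2).restrict
  obtain ⟨R, hR, hs⟩ := hψ.exists_support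
  rw [halfCylMeasure_eq_prod] at *
  rw [integral_prod_symm _ i3, ← integral_neg]
  congr 1; ext t
  have := integral_halfProf_parts ha hc h.res (fun x => hψ.hasDerivAt_x x t)
    (hψ.continuous_dx.comp (by fun_prop)) (by positivity : 0 ≤ R + 1)
    (fun x hx => (hs x t (by linarith [le_abs_self x])).1)
    (fun x hx => (hs x t (by linarith [le_abs_self x])).2.1)
  rw [← mul_neg, ← this, ← integral_const_mul]
  refine setIntegral_congr_fun measurableSet_Ioi fun x hx => ?_
  simp only [modeW, modeX, prof_of_pos (mem_Ioi.1 hx), profD_of_pos (mem_Ioi.1 hx)]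
  ring

/-- The step potential balances the second derivatives away from the origin, leaving only the slope
jump at `x = 0`. The potential is attached to the test function so that each derivative of the mode
is paired with an `L²` function, the form in which the series can be summed. -/
lemma integral_mode_weak (hψ : IsTest T ψ) (ha : 0 < a) (hb : 0 < b) (hc : 0 < c) (hT : 0 < T)
    (hΩ : 0 < Ω) :
    ∫ p, modeT a b c μ p * (-(stepPotential a b c p.1 * dt ψ p)) ∂cylMeasure T +
        ∫ p, modeX a b c μ p * dx ψ p ∂cylMeasure T =
      -(2 * (b * μ / √a) * ∫ t, cos (μ * t) * ψ (0, t) ∂torusMeasure T) := by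
  set h0 : ℝ → ℝ := fun x => stepPotential a b c x * prof a b c μ x with hh0
  have hm : Measurable h0 := measurable_stepPotential.mul h.measurable_prof
  have hbd : ∀ x, |h0 x| ≤ (|a| + |b|) * profConst a b c Ω * exp (-(√a * Ω) * |x|) := fun x => by
    rw [hh0, abs_mul, mul_assoc]
    exact mul_le_mul (abs_stepPotential_le x) (abs_prof_le hΩ h.le) (abs_nonneg _) (by positivity)
  have e1 : ∫ p, modeT a b c μ p * (-(stepPotential a b c p.1 * dt ψ p)) ∂cylMeasure T =
      -(μ ^ 2 * ∫ p, h0 p.1 * cos (μ * p.2) * ψ p ∂cylMeasure T) := by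
    have := integral_separated_sin_dt hψ hT h.freq hm hbd (decay_pos ha hΩ)
    rw [sq, mul_assoc, ← mul_neg, ← this, ← integral_const_mul]
    congr 1; ext p
    simp only [modeT, hh0]; ring
  have i1 := (memLp_separated (T := T) hm hbd (decay_pos ha hΩ) (k := fun t => cos (μ * t))
    (by fun_prop) fun t => abs_cos_le_one _).integrable_mul hψ.memLp
  have i1' := (memLp_cyl_of_exp_bound (T := T) (hm.comp measurable_fst) (decay_pos ha hΩ)
    fun p _ => hbd p.1).integrable_mul hψ.memLp
  have i2 := (h.memLp_modeX (a := a) ha hΩ).integrable_mul hψ.memLp_dx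
  have i2' := (h.memLp_profD_fst (a := a) ha hΩ).integrable_mul hψ.memLp_dx
  have i3 := i2.sub (i1.const_mul (μ ^ 2))
  have i4 := i2'.sub (i1'.const_mul (μ ^ 2))
  have e2 : ∫ p, modeX a b c μ p * dx ψ p ∂cylMeasure T -
      μ ^ 2 * ∫ p, h0 p.1 * cos (μ * p.2) * ψ p ∂cylMeasure T =
      ∫ p, (modeX a b c μ p * dx ψ p - μ ^ 2 * (h0 p.1 * cos (μ * p.2) * ψ p)) ∂cylMeasure T := by
    rw [← integral_const_mul]
    exact (integral_sub i2 (i1.const_mul (μ ^ 2))).symm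
  rw [e1, neg_add_eq_sub, e2]
  obtain ⟨R, hR, hs⟩ := hψ.exists_support
  rw [cylMeasure_eq_prod] at *
  refine (integral_prod_symm _ i3).trans ?_
  rw [← integral_const_mul, ← integral_neg]
  refine integral_congr_ae ?_
  filter_upwards [i4.prod_left_ae] with t ht
  have := integral_profD_parts ha hb hc h.res (fun x => hψ.hasDerivAt_x x t)
    (hψ.continuous_dx.comp (by fun_prop)) (by positivity : 0 ≤ R + 1)
    (fun x hx => (hs x t (by linarith)).1) (fun x hx => (hs x t (by linarith)).2.1)
    (ht.congr (.of_forall fun x => by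
      simp only [Pi.sub_apply, Pi.mul_apply, Function.comp, hh0]; ring))
  rw [show -(2 * (b * μ / √a) * (cos (μ * t) * ψ (0, t))) =
    cos (μ * t) * -(2 * (b * μ / √a) * ψ (0, t)) by ring, ← this, ← integral_const_mul]
  congr 1; ext x
  simp only [Pi.sub_apply, Pi.mul_apply, modeX, hh0]; ring

end IsModeFreq

end Breather
end

noncomputable section
namespace Breather
open Real Set Filter Topology

/-! ### Superposition of modes -/

lemma integral_cos_mul_add {T ν δ : ℝ} {k : ℤ} (hν : ν ≠ 0) (hk : ν * T = k * (2 * π)) :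
    ∫ t in (0)..T, cos (ν * t + δ) = 0 := by
  rw [intervalIntegral.integral_comp_mul_add (fun t => cos t) hν, integral_cos, hk, add_comm,
    sin_add_int_mul_two_pi]
  simp

/-- Arbitrary phases are allowed so that the same lemma covers sines and time translates. -/
lemma integral_cos_mul_cos {T p q : ℝ} (hp : IsFreq T p) (hq : IsFreq T q) (hpq : p ≠ q)
    (h0 : 0 < p + q) (δ ε : ℝ) : ∫ t in (0)..T, cos (p * t + δ) * cos (q * t + ε) = 0 := by
  obtain ⟨k, hk⟩ := hp
  obtain ⟨l, hl⟩ := hq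
  have h1 := integral_cos_mul_add (T := T) (δ := δ - ε) (k := (k : ℤ) - l) (sub_ne_zero.2 hpq)
    (by push_cast; rw [sub_mul, hk, hl]; ring)
  have h2 := integral_cos_mul_add (T := T) (δ := δ + ε) (k := (k : ℤ) + l) h0.ne'
    (by push_cast; rw [add_mul, hk, hl]; ring)
  have e : ∀ t, cos (p * t + δ) * cos (q * t + ε) =
      2⁻¹ * (cos ((p - q) * t + (δ - ε)) + cos ((p + q) * t + (δ + ε))) := fun t => by
    rw [show (p - q) * t + (δ - ε) = (p * t + δ) - (q * t + ε) by ring,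
      show (p + q) * t + (δ + ε) = (p * t + δ) + (q * t + ε) by ring, cos_sub, cos_add (p * t + δ)]
    ring
  simp only [e]
  rw [intervalIntegral.integral_const_mul, intervalIntegral.integral_add
    (Continuous.intervalIntegrable (by fun_prop) _ _)
    (Continuous.intervalIntegrable (by fun_prop) _ _), h1, h2]
  simp

lemma integral_separated_eq_zero {T : ℝ} (hT : 0 < T) {k : ℝ → ℝ} (hk : ∫ t in (0)..T, k t = 0)
    (h : ℝ → ℝ) : ∫ p, h p.1 * k p.2 ∂cylMeasure T = 0 := by
  rw [cylMeasure_eq_prod, integral_prod_mul, integral_torusMeasure hT.le, hk, mul_zero]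

variable {T a b c Ω : ℝ} {μ α : ℕ → ℝ}

/-- The superposition of the modes of frequencies `μ n` with coefficients `α n`. -/
def modeSeries (a b c : ℝ) (μ α : ℕ → ℝ) (p : ℝ × ℝ) : ℝ := ∑' n, α n * modeW a b c (μ n) p

lemma modeSeries_zero (hc : 0 < c) (t : ℝ) :
    modeSeries a b c μ α (0, t) = ∑' n, α n * cos (μ n * t) := by
  simp only [modeSeries, modeW, prof_zero hc, one_mul]

/-- Frequencies and coefficients of an `H¹` superposition of modes. -/
structure IsModeSeries (T a b c Ω : ℝ) (μ α : ℕ → ℝ) : Prop where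
  ha : 0 < a
  hb : 0 < b
  hc : 0 < c
  hΩ : 0 < Ω
  hT : 0 < T
  freq : ∀ n, IsModeFreq T b c Ω (μ n)
  inj : Function.Injective μ
  summable : Summable fun n => |α n|
  summable_sq : Summable fun n => (α n * μ n) ^ 2

namespace IsModeSeries

variable (h : IsModeSeries T a b c Ω μ α)
include h

lemma pos (n : ℕ) : 0 < μ n := h.hΩ.trans_le (h.freq n).le

lemma summable_bound (C : ℝ) : Summable fun n => |α n| * C := h.summable.mul_right C

lemma abs_term_le (n : ℕ) (p : ℝ × ℝ) : ‖α n * modeW a b c (μ n) p‖ ≤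
    |α n| * (profConst a b c Ω * exp (-(√a * Ω) * |p.1|)) := by
  rw [norm_mul, norm_eq_abs, norm_eq_abs]
  exact mul_le_mul_of_nonneg_left ((h.freq n).abs_modeW_le h.hΩ p) (abs_nonneg _)

lemma summable_term (p : ℝ × ℝ) : Summable fun n => α n * modeW a b c (μ n) p :=
  .of_norm_bounded (h.summable_bound _) fun n => h.abs_term_le n p

lemma abs_modeSeries_le (p : ℝ × ℝ) : |modeSeries a b c μ α p| ≤
    (∑' n, |α n|) * profConst a b c Ω * exp (-(√a * Ω) * |p.1|) := by
  rw [mul_assoc, ← tsum_mul_right]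
  exact tsum_of_norm_bounded (h.summable_bound _).hasSum fun n => h.abs_term_le n p

lemma measurable_modeSeries : Measurable (modeSeries a b c μ α) := by
  refine measurable_of_tendsto_metrizable (f := fun n p =>
    ∑ i ∈ Finset.range n, α i * modeW a b c (μ i) p) (fun n => ?_) ?_
  · exact Finset.measurable_fun_sum _ fun i _ => (h.freq i).measurable_modeW.const_mul _
  · exact tendsto_pi_nhds.2 fun p => (h.summable_term p).hasSum.tendsto_sum_nat

lemma memLp_modeSeries : MemLp (modeSeries a b c μ α) 2 (cylMeasure T) :=
  memLp_cyl_of_exp_bound h.measurable_modeSeries (decay_pos h.ha h.hΩ)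
    fun p _ => h.abs_modeSeries_le p

lemma timePeriodic : TimePeriodic T (modeSeries a b c μ α) := fun x t => by
  unfold modeSeries modeW
  congr 1; ext n
  obtain ⟨k, hk⟩ := (h.freq n).freq
  simp only [mul_add, hk, cos_add_nat_mul_two_pi]

/-- Absolute summability of `α` and the common exponential majorant justify exchanging sum and
integral. -/
lemma hasSum_modeSeries_shift_mul (τ : ℝ) {g : ℝ × ℝ → ℝ} (hg : MemLp g 2 (cylMeasure T)) :
    HasSum (fun n => α n * ∫ p, modeW a b c (μ n) (p.1, p.2 + τ) * g p ∂cylMeasure T)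
      (∫ p, modeSeries a b c μ α (p.1, p.2 + τ) * g p ∂cylMeasure T) := by
  have hW : ∀ n, MemLp (fun p : ℝ × ℝ => modeW a b c (μ n) (p.1, p.2 + τ)) 2 (cylMeasure T) :=
    fun n => memLp_cyl_of_exp_bound ((h.freq n).measurable_modeW.comp (by fun_prop))
      (decay_pos h.ha h.hΩ) fun p _ => (h.freq n).abs_modeW_le h.hΩ _
  have hi := fun n => ((hW n).integrable_mul hg).const_mul (α n)
  have hE := (memLp_cyl_exp (decay_pos h.ha h.hΩ) T (profConst a b c Ω)).integrable_mul hg.norm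
  have hs := hasSum_integral_of_summable_integral_norm hi (by
    refine .of_nonneg_of_le (fun n => integral_nonneg fun _ => norm_nonneg _) (fun n => ?_)
      (h.summable_bound (∫ p, profConst a b c Ω * exp (-(√a * Ω) * |p.1|) * ‖g p‖ ∂cylMeasure T))
    rw [← integral_const_mul]
    refine integral_mono (hi n).norm (hE.const_mul |α n|) fun p => ?_
    simp only [Pi.mul_apply]
    rw [← mul_assoc, norm_mul, ← mul_assoc]
    refine mul_le_mul_of_nonneg_right ?_ (norm_nonneg _)
    exact h.abs_term_le n (p.1, p.2 + τ))
  simp only [Pi.mul_apply, ← mul_assoc, tsum_mul_right] at hs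
  simpa only [mul_assoc, integral_const_mul, modeSeries] using hs

lemma hasSum_modeSeries_mul {g : ℝ × ℝ → ℝ} (hg : MemLp g 2 (cylMeasure T)) :
    HasSum (fun n => α n * ∫ p, modeW a b c (μ n) p * g p ∂cylMeasure T)
      (∫ p, modeSeries a b c μ α p * g p ∂cylMeasure T) := by
  simpa only [add_zero] using h.hasSum_modeSeries_shift_mul 0 hg

lemma cos_orthogonal {m n : ℕ} (hmn : m ≠ n) :
    ∫ t in (0)..T, cos (μ m * t) * cos (μ n * t) = 0 := by
  simpa using integral_cos_mul_cos (h.freq m).freq (h.freq n).freq (h.inj.ne hmn)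
    (add_pos (h.pos m) (h.pos n)) 0 0

lemma sin_orthogonal {m n : ℕ} (hmn : m ≠ n) :
    ∫ t in (0)..T, sin (μ m * t) * sin (μ n * t) = 0 := by
  have := integral_cos_mul_cos (h.freq m).freq (h.freq n).freq (h.inj.ne hmn)
    (add_pos (h.pos m) (h.pos n)) (-(π / 2)) (-(π / 2))
  simpa only [← sub_eq_add_neg, cos_sub_pi_div_two] using this

/-- For the derivatives only `α_n μ_n ∈ ℓ²` is available, so orthogonality replaces absolute
convergence. The limit is described only through its pairings with `L²` functions, which is all that
the weak formulations use. -/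
lemma exists_superposition {M : ℕ → ℝ × ℝ → ℝ} (hm : ∀ n, Measurable (M n))
    (hb : ∀ n p, |M n p| ≤ profConst a b c Ω * μ n * exp (-(√a * Ω) * |p.1|))
    (ho : ∀ m n, m ≠ n → ∫ p, M m p * M n p ∂cylMeasure T = 0) :
    ∃ F, MemLp F 2 (cylMeasure T) ∧ ∀ g, MemLp g 2 (cylMeasure T) →
      HasSum (fun n => α n * ∫ p, M n p * g p ∂cylMeasure T) (∫ p, F p * g p ∂cylMeasure T) := by
  have hM : ∀ n, MemLp (M n) 2 (cylMeasure T) := fun n =>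
    memLp_cyl_of_exp_bound (hm n) (decay_pos h.ha h.hΩ) fun p _ => hb n p
  have hE := (memLp_cyl_exp (decay_pos h.ha h.hΩ) T (profConst a b c Ω)).integrable_sq
  obtain ⟨F, hF, hs⟩ := exists_memLp_hasSum_of_orthogonal (f := fun n p => α n * M n p)
    (μ := cylMeasure T) (fun n => (hM n).const_mul _)
    (fun m n hmn => by
      have e : ∀ p, α m * M m p * (α n * M n p) = α m * α n * (M m p * M n p) := fun p => by ring
      simp only [e, integral_const_mul, ho m n hmn, mul_zero])
    (by
      refine .of_nonneg_of_le (fun n => integral_nonneg fun _ => sq_nonneg _) (fun n => ?_)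
        (h.summable_sq.mul_right (∫ p, (profConst a b c Ω * exp (-(√a * Ω) * |p.1|)) ^ 2
          ∂cylMeasure T))
      rw [← integral_const_mul]
      refine integral_mono ((hM n).const_mul (α n)).integrable_sq (hE.const_mul _) fun p => ?_
      simp only [mul_pow, ← sq_abs (M n p)]
      rw [mul_assoc]
      refine mul_le_mul_of_nonneg_left ?_ (sq_nonneg _)
      calc |M n p| ^ 2 ≤ (profConst a b c Ω * μ n * exp (-(√a * Ω) * |p.1|)) ^ 2 :=
            pow_le_pow_left₀ (abs_nonneg _) (hb n p) 2
        _ = _ := by ring)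
  refine ⟨F, hF, fun g hg => ?_⟩
  simpa only [mul_assoc, integral_const_mul] using hs g hg

lemma exists_dx : ∃ wx, MemLp wx 2 (cylMeasure T) ∧ ∀ g, MemLp g 2 (cylMeasure T) →
    HasSum (fun n => α n * ∫ p, modeX a b c (μ n) p * g p ∂cylMeasure T)
      (∫ p, wx p * g p ∂cylMeasure T) := by
  refine h.exists_superposition (fun n => (h.freq n).measurable_modeX)
    (fun n => (h.freq n).abs_modeX_le h.hΩ) fun m n hmn => ?_
  have := integral_separated_eq_zero h.hT (h.cos_orthogonal hmn)
    fun x => profD a b c (μ m) x * profD a b c (μ n) x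
  rw [← this]; congr 1; ext p; simp only [modeX]; ring

lemma exists_dt : ∃ wt, MemLp wt 2 (cylMeasure T) ∧ ∀ g, MemLp g 2 (cylMeasure T) →
    HasSum (fun n => α n * ∫ p, modeT a b c (μ n) p * g p ∂cylMeasure T)
      (∫ p, wt p * g p ∂cylMeasure T) := by
  refine h.exists_superposition (fun n => (h.freq n).measurable_modeT)
    (fun n => (h.freq n).abs_modeT_le h.hΩ) fun m n hmn => ?_
  have := integral_separated_eq_zero h.hT (h.sin_orthogonal hmn)
    fun x => μ m * prof a b c (μ m) x * (μ n * prof a b c (μ n) x)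
  rw [← this]; congr 1; ext p; simp only [modeT]; ring

variable {wx wt : ℝ × ℝ → ℝ}

lemma isWeakDx (hwx : MemLp wx 2 (cylMeasure T))
    (hs : ∀ g, MemLp g 2 (cylMeasure T) →
      HasSum (fun n => α n * ∫ p, modeX a b c (μ n) p * g p ∂cylMeasure T)
        (∫ p, wx p * g p ∂cylMeasure T)) : IsWeakDx T (modeSeries a b c μ α) wx := by
  refine ⟨hwx, fun ψ hψ => ?_⟩
  have h1 := h.hasSum_modeSeries_mul hψ.memLp_dx
  simp only [fun n => (h.freq n).integral_modeW_dx hψ h.ha h.hc h.hΩ, mul_neg] at h1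
  exact h1.unique (hs ψ hψ.memLp).neg

lemma isWeakDt (hwt : MemLp wt 2 (cylMeasure T))
    (hs : ∀ g, MemLp g 2 (cylMeasure T) →
      HasSum (fun n => α n * ∫ p, modeT a b c (μ n) p * g p ∂cylMeasure T)
        (∫ p, wt p * g p ∂cylMeasure T)) : IsWeakDt T (modeSeries a b c μ α) wt := by
  refine ⟨hwt, fun ψ hψ => ?_⟩
  have h1 := h.hasSum_modeSeries_mul hψ.memLp_dt
  simp only [fun n => (h.freq n).integral_modeW_dt hψ h.ha h.hT h.hΩ, mul_neg] at h1
  exact h1.unique (hs ψ hψ.memLp).neg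

lemma abs_trace_le (t : ℝ) : |modeSeries a b c μ α (0, t)| ≤ (∑' n, |α n|) * profConst a b c Ω := by
  simpa using h.abs_modeSeries_le (0, t)

lemma hasSum_trace_mul {η : ℝ → ℝ} (hη : Continuous η) :
    HasSum (fun n => α n * ∫ t, cos (μ n * t) * η t ∂torusMeasure T)
      (∫ t, modeSeries a b c μ α (0, t) * η t ∂torusMeasure T) := by
  have hη' : Integrable η (torusMeasure T) := (memLp_of_continuous hη T 1).integrable le_rfl
  have hi : ∀ n, Integrable (fun t => α n * (cos (μ n * t) * η t)) (torusMeasure T) := fun n =>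
    (hη'.bdd_mul (c := 1) (by fun_prop) (.of_forall fun t => abs_cos_le_one _)).const_mul _
  have hs := hasSum_integral_of_summable_integral_norm hi (by
    refine .of_nonneg_of_le (fun n => integral_nonneg fun _ => norm_nonneg _) (fun n => ?_)
      (h.summable_bound (∫ t, ‖η t‖ ∂torusMeasure T))
    rw [← integral_const_mul]
    refine integral_mono (hi n).norm (hη'.norm.const_mul |α n|) fun t => ?_
    simp only [norm_mul, norm_eq_abs]
    exact mul_le_mul_of_nonneg_left (mul_le_of_le_one_left (abs_nonneg _) (abs_cos_le_one _))
      (abs_nonneg _))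
  simp only [← mul_assoc, tsum_mul_right] at hs
  simpa only [mul_assoc, integral_const_mul, modeSeries_zero h.hc] using hs

lemma isTraceAtZero (hwx : MemLp wx 2 (cylMeasure T))
    (hs : ∀ g, MemLp g 2 (cylMeasure T) →
      HasSum (fun n => α n * ∫ p, modeX a b c (μ n) p * g p ∂cylMeasure T)
        (∫ p, wx p * g p ∂cylMeasure T)) :
    IsTraceAtZero T (modeSeries a b c μ α) wx fun t => modeSeries a b c μ α (0, t) := by
  refine ⟨memLp_of_bounded (h.measurable_modeSeries.comp (by fun_prop)) h.abs_trace_le,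
    fun ψ hψ => ?_⟩
  have hS : MeasurableSet {p : ℝ × ℝ | 0 < p.1} := measurableSet_lt measurable_const measurable_fst
  -- Integrals over the half cylinder become pairings with a truncated `L²` function on the whole
  -- cylinder, to which the termwise expansions apply.
  have half : ∀ u v : ℝ × ℝ → ℝ, ∫ p, u p * v p ∂halfCylMeasure T =
      ∫ p, u p * indicator {p : ℝ × ℝ | 0 < p.1} v p ∂cylMeasure T := fun u v => by
    rw [halfCylMeasure_eq_restrict, ← integral_indicator hS]
    congr 1; ext p
    rw [indicator_mul_right]
  have split : ∀ u v : ℝ × ℝ → ℝ, MemLp u 2 (cylMeasure T) → MemLp v 2 (cylMeasure T) →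
      ∫ p, (u p * dx ψ p + v p * ψ p) ∂halfCylMeasure T =
      ∫ p, u p * dx ψ p ∂halfCylMeasure T + ∫ p, v p * ψ p ∂halfCylMeasure T := fun u v hu hv => by
    rw [halfCylMeasure_eq_restrict]
    exact integral_add (hu.integrable_mul hψ.memLp_dx).restrict (hv.integrable_mul hψ.memLp).restrict
  have h1 := (h.hasSum_modeSeries_mul (hψ.memLp_dx.indicator hS)).add
    (hs _ (hψ.memLp.indicator hS))
  simp only [← half, ← mul_add] at h1
  rw [← split _ _ h.memLp_modeSeries hwx] at h1
  simp only [fun n => (split _ _ ((h.freq n).memLp_modeW h.ha h.hΩ)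
      ((h.freq n).memLp_modeX h.ha h.hΩ)).symm,
    fun n => (h.freq n).integral_half_mode hψ h.ha h.hc h.hΩ, mul_neg] at h1
  exact h1.unique (h.hasSum_trace_mul (hψ.continuous.comp (by fun_prop))).neg

lemma hasSum_weak (hwx : MemLp wx 2 (cylMeasure T)) (hwt : MemLp wt 2 (cylMeasure T))
    (hsx : ∀ g, MemLp g 2 (cylMeasure T) →
      HasSum (fun n => α n * ∫ p, modeX a b c (μ n) p * g p ∂cylMeasure T)
        (∫ p, wx p * g p ∂cylMeasure T))
    (hst : ∀ g, MemLp g 2 (cylMeasure T) →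
      HasSum (fun n => α n * ∫ p, modeT a b c (μ n) p * g p ∂cylMeasure T)
        (∫ p, wt p * g p ∂cylMeasure T)) {ψ : ℝ × ℝ → ℝ} (hψ : IsTest T ψ) :
    HasSum (fun n => α n * -(2 * (b * μ n / √a) * ∫ t, cos (μ n * t) * ψ (0, t) ∂torusMeasure T))
      (∫ p, (-stepPotential a b c p.1 * wt p * dt ψ p + wx p * dx ψ p) ∂cylMeasure T) := by
  have hg : MemLp (fun p : ℝ × ℝ => -(stepPotential a b c p.1 * dt ψ p)) 2 (cylMeasure T) := by
    refine MemLp.of_le_mul (c := |a| + |b|) hψ.memLp_dt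
      ((measurable_stepPotential.comp measurable_fst).mul
        hψ.continuous_dt.measurable).neg.aestronglyMeasurable (.of_forall fun p => ?_)
    rw [norm_neg, norm_mul]
    exact mul_le_mul_of_nonneg_right (abs_stepPotential_le _) (norm_nonneg _)
  have h1 := (hst _ hg).add (hsx _ hψ.memLp_dx)
  simp only [← mul_add, fun n => (h.freq n).integral_mode_weak hψ h.ha h.hb h.hc h.hT h.hΩ] at h1
  convert h1 using 1
  refine Eq.trans ?_ (integral_add (hwt.integrable_mul hg) (hwx.integrable_mul hψ.memLp_dx))
  congr 1; ext p; ring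

end IsModeSeries

end Breather
end

noncomputable section
namespace Breather
open Real Set Filter Topology

/-! ### Separation of the solutions by their frequencies -/

section

variable {T a b c Ω : ℝ} {μ α : ℕ → ℝ}

lemma integral_modeW_shift_mul_eq_zero (hT : 0 < T) {p q : ℝ} (hp : IsFreq T p) (hq : IsFreq T q)
    (hpq : p ≠ q) (h0 : 0 < p + q) (τ σ : ℝ) :
    ∫ x, modeW a b c p (x.1, x.2 + τ) * modeW a b c q (x.1, x.2 + σ) ∂cylMeasure T = 0 := by
  have := integral_separated_eq_zero hT (integral_cos_mul_cos hp hq hpq h0 (p * τ) (q * σ))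
    fun x => prof a b c p x * prof a b c q x
  rw [← this]; congr 1; ext x; simp only [modeW, mul_add]; ring

lemma IsModeFreq.memLp_modeW_shift {ν : ℝ} (h : IsModeFreq T b c Ω ν) (ha : 0 < a) (hΩ : 0 < Ω)
    (τ : ℝ) : MemLp (fun p : ℝ × ℝ => modeW a b c ν (p.1, p.2 + τ)) 2 (cylMeasure T) :=
  memLp_cyl_of_exp_bound (h.measurable_modeW.comp (by fun_prop)) (decay_pos ha hΩ)
    fun _ _ => h.abs_modeW_le hΩ _

/-- The integral factors: the profile is continuous and equals 1 at the origin, and `cos²` has mean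
`1/2` over the period. -/
lemma IsModeFreq.integral_modeW_shift_sq_pos {ν : ℝ} (h : IsModeFreq T b c Ω ν) (ha : 0 < a)
    (hc : 0 < c) (hΩ : 0 < Ω) (hT : 0 < T) (τ : ℝ) :
    0 < ∫ x, modeW a b c ν (x.1, x.2 + τ) * modeW a b c ν (x.1, x.2 + τ) ∂cylMeasure T := by
  have hν : 0 < ν := hΩ.trans_le h.le
  have e : ∀ x : ℝ × ℝ, modeW a b c ν (x.1, x.2 + τ) * modeW a b c ν (x.1, x.2 + τ) =
      prof a b c ν x.1 ^ 2 * cos (ν * (x.2 + τ)) ^ 2 := fun x => by simp only [modeW]; ring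
  simp only [e]
  rw [cylMeasure_eq_prod, integral_prod_mul (fun x => prof a b c ν x ^ 2)
    fun t => cos (ν * (t + τ)) ^ 2, integral_torusMeasure hT.le]
  refine mul_pos ?_ ?_
  · have hcont := (continuous_prof (a := a) h.res).pow 2
    have hi : Integrable fun x => prof a b c ν x ^ 2 := by
      refine Integrable.mono' ((integrable_exp_neg_mul_abs (mul_pos two_pos (decay_pos ha hΩ))).const_mul
        (profConst a b c Ω ^ 2)) hcont.aestronglyMeasurable (.of_forall fun x => ?_)
      rw [norm_pow, norm_eq_abs]
      refine (pow_le_pow_left₀ (abs_nonneg _) (abs_prof_le hΩ h.le) 2).trans_eq ?_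
      rw [mul_pow, ← exp_nat_mul]; congr 2; push_cast; ring
    rw [integral_pos_iff_support_of_nonneg (fun x => sq_nonneg _) hi]
    exact hcont.isOpen_support.measure_pos _ ⟨0, by simp [prof_zero hc]⟩
  · obtain ⟨k, hk⟩ := h.freq
    have h1 := integral_cos_mul_add (T := T) (ν := 2 * ν) (δ := 2 * (ν * τ)) (k := 2 * (k : ℤ))
      (by positivity) (by push_cast; rw [mul_assoc, hk]; ring)
    have e2 : ∀ t, cos (ν * (t + τ)) ^ 2 = 1 / 2 + cos (2 * ν * t + 2 * (ν * τ)) / 2 := fun t => by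
      rw [cos_sq]; ring_nf
    simp only [e2]
    rw [intervalIntegral.integral_add (by simp) (Continuous.intervalIntegrable (by fun_prop) _ _)]
    simp [intervalIntegral.integral_div, h1, hT]

namespace IsModeSeries

variable (h : IsModeSeries T a b c Ω μ α)
include h

lemma integral_mul_modeW_ne_zero {n : ℕ} (hn : α n ≠ 0) (τ : ℝ) :
    ∫ p, modeSeries a b c μ α (p.1, p.2 + τ) * modeW a b c (μ n) (p.1, p.2 + τ) ∂cylMeasure T ≠ 0 := by
  have h1 := h.hasSum_modeSeries_shift_mul τ ((h.freq n).memLp_modeW_shift h.ha h.hΩ τ)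
  have h2 := hasSum_single (f := fun m => α m * ∫ p, modeW a b c (μ m) (p.1, p.2 + τ) *
      modeW a b c (μ n) (p.1, p.2 + τ) ∂cylMeasure T) n fun m hm => by
    rw [integral_modeW_shift_mul_eq_zero h.hT (h.freq m).freq (h.freq n).freq (h.inj.ne hm)
      (add_pos (h.pos m) (h.pos n)), mul_zero]
  rw [h1.unique h2]
  exact mul_ne_zero hn ((h.freq n).integral_modeW_shift_sq_pos h.ha h.hc h.hΩ h.hT τ).ne'

lemma integral_mul_modeW_eq_zero {Ω' ν : ℝ} (hΩ' : 0 < Ω') (hν : IsModeFreq T b c Ω' ν)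
    (hlt : ν < Ω) (τ σ : ℝ) :
    ∫ p, modeSeries a b c μ α (p.1, p.2 + τ) * modeW a b c ν (p.1, p.2 + σ) ∂cylMeasure T = 0 := by
  have h1 := h.hasSum_modeSeries_shift_mul τ (hν.memLp_modeW_shift h.ha hΩ' σ)
  simp only [fun m => integral_modeW_shift_mul_eq_zero (a := a) (b := b) (c := c) h.hT
    (h.freq m).freq hν.freq (hlt.trans_le (h.freq m).le).ne'
    (add_pos (h.pos m) (hΩ'.trans_le hν.le)) τ σ, mul_zero] at h1
  exact h1.unique hasSum_zero

lemma not_ae_zero {n : ℕ} (hn : α n ≠ 0) : ¬ modeSeries a b c μ α =ᵐ[cylMeasure T] 0 := fun h0 => by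
  have h1 := h.integral_mul_modeW_ne_zero hn 0
  simp only [add_zero] at h1
  refine h1 (integral_eq_zero_of_ae ?_)
  filter_upwards [h0] with p hp
  rw [hp, Pi.zero_apply, zero_mul]

/-- Test both series against the mode of frequency `μ n`: the first pairing is nonzero, the second
vanishes since all frequencies in the second series exceed `μ n`. With a shift on either side the
lemma applies whichever of two solutions has the lower frequency. -/
lemma not_ae_eq {Ω' : ℝ} {μ' α' : ℕ → ℝ} (h' : IsModeSeries T a b c Ω' μ' α') {n : ℕ}
    (hn : α n ≠ 0) (hlt : μ n < Ω') (τ σ : ℝ) :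
    ¬ (fun p : ℝ × ℝ => modeSeries a b c μ α (p.1, p.2 + τ)) =ᵐ[cylMeasure T]
      fun p => modeSeries a b c μ' α' (p.1, p.2 + σ) := fun h0 => by
  refine h.integral_mul_modeW_ne_zero hn τ ?_
  rw [← h'.integral_mul_modeW_eq_zero h.hΩ (h.freq n) hlt σ τ]
  refine integral_congr_ae ?_
  filter_upwards [h0] with p hp
  rw [hp]

end IsModeSeries

end

/-! ### The nonlinear problem -/

/-- A profile as provided by `exists_profile`. -/
structure IsProfile (U : ℝ → ℝ) (B : ℝ) : Prop where
  measurable : Measurable U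
  bound : ∀ t, |U t| ≤ B
  odd : ∀ t, U (-t) = -U t
  antiperiodic : ∀ t, U (t + π) = -U t
  eq : ∀ n : ℕ, (2 * n + 1) * ∫ t in (0)..(2 * π), U t ^ 3 * sin ((2 * n + 1) * t) =
      ∫ t in (0)..(2 * π), U t * sin ((2 * n + 1) * t)
  pos : 0 < ∫ t in (0)..(2 * π), U t * sin t

lemma IsProfile.sinCoeff_zero_pos {U : ℝ → ℝ} {B : ℝ} (hU : IsProfile U B) : 0 < sinCoeff U 0 := by
  have := hU.pos
  simp only [sinCoeff, CharP.cast_eq_zero, mul_zero, zero_add, one_mul]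
  positivity

/-- The amplitude of the breather with fundamental frequency `Ω`. -/
def amplitude (a b γ Ω : ℝ) : ℝ := √(2 * b / (√a * (-γ) * Ω))

/-- The odd multiples of the fundamental frequency. -/
def breatherFreq (Ω : ℝ) (n : ℕ) : ℝ := (2 * n + 1) * Ω

/-- The coefficients of the breather with fundamental frequency `Ω`. -/
def breatherCoeff (U : ℝ → ℝ) (a b γ Ω : ℝ) (n : ℕ) : ℝ :=
  -(amplitude a b γ Ω * sinCoeff U n / breatherFreq Ω n)

variable {U : ℝ → ℝ} {B a b c γ Ω : ℝ} {N : ℕ}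

lemma breatherFreq_pos (hΩ : 0 < Ω) (n : ℕ) : 0 < breatherFreq Ω n := by
  unfold breatherFreq; positivity

lemma breatherCoeff_mul_freq (hΩ : 0 < Ω) (n : ℕ) :
    breatherCoeff U a b γ Ω n * breatherFreq Ω n = -(amplitude a b γ Ω * sinCoeff U n) := by
  rw [breatherCoeff, neg_mul, div_mul_cancel₀ _ (breatherFreq_pos hΩ n).ne']

lemma amplitude_pos (ha : 0 < a) (hb : 0 < b) (hγ : γ < 0) (hΩ : 0 < Ω) : 0 < amplitude a b γ Ω := by
  have := sqrt_pos.2 ha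
  have : 0 < -γ := by linarith
  unfold amplitude; positivity

/-- The balance between the cubic term and the linear slope jump that fixes the amplitude; `γ < 0`
gives it the right sign. -/
lemma amplitude_sq (ha : 0 < a) (hb : 0 < b) (hγ : γ < 0) (hΩ : 0 < Ω) :
    γ * amplitude a b γ Ω ^ 2 * Ω = -(2 * (b / √a)) := by
  have h1 := sqrt_pos.2 ha
  have h2 : 0 < -γ := by linarith
  rw [amplitude, sq_sqrt (by positivity)]
  have : γ ≠ 0 := hγ.ne
  field_simp

lemma isModeFreq_breatherFreq (hΩ : 0 < Ω) {m : ℕ} (hres : √b * Ω * c = (2 * m + 1) * (π / 2))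
    (n : ℕ) : IsModeFreq (2 * π * N / Ω) b c Ω (breatherFreq Ω n) where
  le := le_mul_of_one_le_left hΩ.le (by linarith [n.cast_nonneg (α := ℝ)])
  freq := ⟨(2 * n + 1) * N, by unfold breatherFreq; push_cast; field_simp⟩
  -- A product of odd numbers is odd: `(2n+1)(2m+1) = 2(2nm + n + m) + 1`.
  res := cos_eq_zero_iff.2 ⟨2 * n * m + n + m, by
    rw [breatherFreq, show √b * ((2 * n + 1) * Ω) * c = (2 * n + 1) * (√b * Ω * c) by ring, hres]
    push_cast; ring⟩

/-- `x y ≤ x² + y²` compares with two convergent series of squares. -/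
lemma summable_sinCoeff_div (hU : IsProfile U B) :
    Summable fun n : ℕ => |sinCoeff U n| / (2 * n + 1) := by
  have h1 := summable_sinCoeff_sq hU.measurable hU.bound hU.odd hU.antiperiodic
  have h2 : Summable fun n : ℕ => 1 / ((n + 1 : ℕ) : ℝ) ^ 2 :=
    (summable_nat_add_iff 1).2 (Real.summable_one_div_nat_pow.2 one_lt_two)
  refine .of_nonneg_of_le (fun n => by positivity) (fun n => ?_) (h1.add h2)
  have h3 : (1 : ℝ) / (2 * n + 1) ≤ 1 / ((n + 1 : ℕ) : ℝ) :=
    one_div_le_one_div_of_le (by positivity) (by push_cast; linarith [n.cast_nonneg (α := ℝ)])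
  have h4 : (0 : ℝ) < 1 / (2 * n + 1) := by positivity
  rw [div_eq_mul_one_div, ← sq_abs, ← one_div_pow]
  nlinarith [abs_nonneg (sinCoeff U n), mul_le_mul_of_nonneg_left h3 (abs_nonneg (sinCoeff U n)),
    sq_nonneg (|sinCoeff U n| - 1 / ((n + 1 : ℕ) : ℝ)), sq_nonneg (|sinCoeff U n|),
    sq_nonneg (1 / ((n + 1 : ℕ) : ℝ))]

lemma isModeSeries_breather (hU : IsProfile U B) (ha : 0 < a) (hb : 0 < b) (hc : 0 < c)
    (hγ : γ < 0) (hΩ : 0 < Ω) (hN : 0 < N) {m : ℕ} (hres : √b * Ω * c = (2 * m + 1) * (π / 2)) :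
    IsModeSeries (2 * π * N / Ω) a b c Ω (breatherFreq Ω) (breatherCoeff U a b γ Ω) where
  ha := ha
  hb := hb
  hc := hc
  hΩ := hΩ
  hT := by positivity
  freq := isModeFreq_breatherFreq hΩ hres
  inj := fun i j hij => by
    have := mul_right_cancel₀ hΩ.ne' hij
    exact_mod_cast (by linarith : (i : ℝ) = j)
  summable := by
    refine ((summable_sinCoeff_div hU).mul_left (amplitude a b γ Ω / Ω)).congr fun n => ?_
    rw [breatherCoeff, abs_neg, abs_div, abs_mul, abs_of_pos (breatherFreq_pos hΩ n),
      abs_of_pos (amplitude_pos ha hb hγ hΩ), breatherFreq]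
    field_simp
  summable_sq := by
    refine ((summable_sinCoeff_sq hU.measurable hU.bound hU.odd hU.antiperiodic).mul_left
      (amplitude a b γ Ω ^ 2)).congr fun n => ?_
    rw [breatherCoeff_mul_freq hΩ]; ring

lemma breatherCoeff_zero_ne (hU : IsProfile U B) (ha : 0 < a) (hb : 0 < b) (hγ : γ < 0)
    (hΩ : 0 < Ω) : breatherCoeff U a b γ Ω 0 ≠ 0 :=
  neg_ne_zero.2 (div_ne_zero (mul_ne_zero (amplitude_pos ha hb hγ hΩ).ne' hU.sinCoeff_zero_pos.ne')
    (breatherFreq_pos hΩ 0).ne')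

lemma sinCoeff_pow_three (hU : IsProfile U B) (n : ℕ) :
    (2 * n + 1) * sinCoeff (fun t => U t ^ 3) n = sinCoeff U n := by
  rw [sinCoeff, sinCoeff, ← hU.eq n]; ring

/-- The breather with fundamental frequency `Ω` is a weak solution. -/
theorem isWeakSolution_breather (hU : IsProfile U B) (ha : 0 < a) (hb : 0 < b) (hc : 0 < c)
    (hγ : γ < 0) (hΩ : 0 < Ω) (hN : 0 < N) {m : ℕ} (hres : √b * Ω * c = (2 * m + 1) * (π / 2)) :
    IsWeakSolution (2 * π * N / Ω) (stepPotential a b c) γ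
      (modeSeries a b c (breatherFreq Ω) (breatherCoeff U a b γ Ω)) := by
  have h := isModeSeries_breather hU ha hb hc hγ hΩ hN hres
  obtain ⟨wx, hwx, hsx⟩ := h.exists_dx
  obtain ⟨wt, hwt, hst⟩ := h.exists_dt
  set l := amplitude a b γ Ω with hl
  set T := 2 * π * N / Ω with hT
  have hsin : ∀ (n : ℕ) (t : ℝ), sin ((2 * n + 1) * (Ω * t)) = sin (breatherFreq Ω n * t) :=
    fun n t => by rw [breatherFreq, mul_assoc]
  refine ⟨h.timePeriodic, h.memLp_modeSeries, wx, wt,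
    fun t => modeSeries a b c (breatherFreq Ω) (breatherCoeff U a b γ Ω) (0, t),
    -- Since `α_n μ_n = -l * sinCoeff U n`, formal differentiation of the trace gives `l U(Ω t)`;
    -- this is bounded, hence in `L³`.
    fun t => l * U (Ω * t), h.isWeakDx hwx hsx, h.isWeakDt hwt hst, h.isTraceAtZero hwx hsx,
    ⟨?_, fun η hη hper => ?_⟩, fun ψ hψ => ?_⟩
  · exact (memLp_of_bounded (hU.measurable.comp (measurable_const_mul Ω))
      fun t => hU.bound _).const_mul l
  · have hd : Continuous (deriv η) := hη.continuous_deriv (by simp)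
    have hη' : ∀ t, HasDerivAt η (deriv η t) t := fun t =>
      ((hη.differentiable (by simp)) t).hasDerivAt
    have h1 := h.hasSum_trace_mul hd
    have h2 := (hasSum_sinCoeff_scaled hU.measurable hU.bound hU.odd hU.antiperiodic
      hη.continuous hΩ N).mul_left (-l)
    rw [← hT] at h2
    have e : ∀ n : ℕ, breatherCoeff U a b γ Ω n *
        ∫ t, cos (breatherFreq Ω n * t) * deriv η t ∂torusMeasure T =
        -l * (sinCoeff U n * ∫ t in (0)..T, sin ((2 * n + 1) * (Ω * t)) * η t) := fun n => by
      rw [integral_torusMeasure h.hT.le, integral_cos_mul_deriv (h.freq n).freq hη' hd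
        (by simpa using hper 0), ← mul_assoc, breatherCoeff_mul_freq hΩ]
      simp only [hsin]; ring
    simp only [e] at h1
    rw [h1.unique h2, integral_torusMeasure h.hT.le]
    simp only [mul_assoc, intervalIntegral.integral_const_mul]; ring
  · have h1 := h.hasSum_weak hwx hwt hsx hst hψ
    have hcont : Continuous fun t => dt ψ (0, t) := hψ.continuous_dt.comp (by fun_prop)
    have h2 := (hasSum_sinCoeff_scaled (U := fun t => U t ^ 3) (hU.measurable.pow_const 3)
      (B := B ^ 3) (fun t => by rw [abs_pow]; exact pow_le_pow_left₀ (abs_nonneg _) (hU.bound t) 3)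
      (fun t => by rw [hU.odd]; ring) (fun t => by rw [hU.antiperiodic]; ring) hcont hΩ N).mul_left
      (γ * l ^ 3)
    rw [← hT] at h2
    -- Mode by mode, the slope jump equals the cubic term: this combines the profile equation
    -- `(2n+1) sinCoeff (U³) n = sinCoeff U n` with the amplitude balance.
    have e : ∀ n : ℕ, breatherCoeff U a b γ Ω n * -(2 * (b * breatherFreq Ω n / √a) *
        ∫ t, cos (breatherFreq Ω n * t) * ψ (0, t) ∂torusMeasure T) =
        γ * l ^ 3 * (sinCoeff (fun t => U t ^ 3) n *
          ∫ t in (0)..T, sin ((2 * n + 1) * (Ω * t)) * dt ψ (0, t)) := fun n => by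
      simp only [hsin]
      rw [integral_sin_mul_deriv (h.freq n).freq (hψ.hasDerivAt_t 0) hcont,
        integral_torusMeasure h.hT.le]
      have e1 := breatherCoeff_mul_freq (U := U) (a := a) (b := b) (γ := γ) hΩ n
      have e2 := sinCoeff_pow_three hU n
      have e3 := amplitude_sq ha hb hγ hΩ
      rw [← hl] at e1 e3
      set I := ∫ t in (0)..T, cos (breatherFreq Ω n * t) * ψ (0, t)
      calc _ = -(2 * (b / √a) * I) * (breatherCoeff U a b γ Ω n * breatherFreq Ω n) := by ring
        _ = 2 * (b / √a) * I * l * sinCoeff U n := by rw [e1]; ring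
        _ = -(γ * l ^ 2 * Ω) * I * l * sinCoeff U n := by rw [e3]; ring
        _ = _ := by rw [← e2, breatherFreq]; ring
    simp only [e] at h1
    rw [h1.unique h2, integral_torusMeasure h.hT.le]
    simp only [mul_pow, mul_assoc, intervalIntegral.integral_const_mul]; ring

end Breather
end

/-! ### Choice of the fundamental frequencies and conclusion -/

theorem mainTheorem3 (a b c ω γ : ℝ) (ha : 0 < a) (hb : 0 < b) (hc : 0 < c)
    (hω : ∃ m n : ℕ,
      Real.sqrt b * ω * c * (2 / Real.pi) = (2 * (m : ℝ) + 1) / (2 * (n : ℝ) + 1))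
    (hγ : γ < 0) :
    ∃ w : ℕ → ℝ × ℝ → ℝ,
      (∀ n : ℕ,
        Breather.IsWeakSolution (2 * Real.pi / ω) (Breather.stepPotential a b c) γ (w n) ∧
        ¬ (w n =ᵐ[Breather.cylMeasure (2 * Real.pi / ω)] 0) ∧
        ∃ C ρ : ℝ, 0 < C ∧ 0 < ρ ∧
          ∀ x t : ℝ, |w n (x, t)| ≤ C * Real.exp (-ρ * |x|)) ∧
      ∀ m n : ℕ, m ≠ n → ∀ τ : ℝ,
        ¬ ((fun p : ℝ × ℝ => w m (p.1, p.2 + τ))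
            =ᵐ[Breather.cylMeasure (2 * Real.pi / ω)] w n) := by
  open Breather in
  obtain ⟨U, hm, ⟨B, hB⟩, hodd, hpi, heq, hpos⟩ := exists_profile
  have hU : IsProfile U B := ⟨hm, hB, hodd, hpi, heq, hpos⟩
  obtain ⟨p, q, hpq⟩ := hω
  have hb' := Real.sqrt_pos.2 hb
  have hω0 : 0 < ω := by
    have h1 : 0 < Real.sqrt b * ω * c * (2 / Real.pi) := by rw [hpq]; positivity
    by_contra hle
    have h2 : Real.sqrt b * ω * c * (2 / Real.pi) = (Real.sqrt b * c * (2 / Real.pi)) * ω := by ring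
    rw [h2] at h1
    exact absurd h1 (not_lt.2 (mul_nonpos_of_nonneg_of_nonpos (by positivity) (not_lt.1 hle)))
  -- The factor `2q + 1` clears the denominator in the frequency condition, making `√b Ω c` an odd
  -- multiple of `π / 2`. The odd factor `2M + 1` preserves this and yields infinitely many choices.
  -- Multiplying `ω` by an integer keeps `T = 2π / ω` a period.
  set N : ℕ → ℕ := fun M => (2 * q + 1) * (2 * M + 1) with hN
  set Ω : ℕ → ℝ := fun M => N M * ω with hΩ
  have hN0 : ∀ M, 0 < N M := fun M => by positivity
  have hΩ0 : ∀ M, 0 < Ω M := fun M => mul_pos (Nat.cast_pos.2 (hN0 M)) hω0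
  have hT : ∀ M, 2 * Real.pi * N M / Ω M = 2 * Real.pi / ω := fun M => by
    have := (Nat.cast_pos (α := ℝ)).2 (hN0 M)
    simp only [hΩ]; field_simp
  have hres : ∀ M, Real.sqrt b * Ω M * c =
      (2 * ((2 * p * M + p + M : ℕ) : ℝ) + 1) * (Real.pi / 2) := fun M => by
    have h1 : Real.sqrt b * ω * c * (2 * q + 1) = (2 * p + 1) * (Real.pi / 2) := by
      field_simp at hpq ⊢; linarith
    have h2 : Real.sqrt b * Ω M * c = (Real.sqrt b * ω * c * (2 * q + 1)) * (2 * M + 1) := by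
      simp only [hΩ, hN]; push_cast; ring
    rw [h2, h1]; push_cast; ring
  have hS := fun M => isModeSeries_breather hU ha hb hc hγ (hΩ0 M) (hN0 M) (hres M)
  have hW := fun M => isWeakSolution_breather hU ha hb hc hγ (hΩ0 M) (hN0 M) (hres M)
  have hα := fun M => breatherCoeff_zero_ne hU ha hb hγ (hΩ0 M)
  simp only [hT] at hS hW
  -- The lowest frequencies increase strictly with the index, which is what separates the solutions.
  have hlt : ∀ m n, m < n → breatherFreq (Ω m) 0 < Ω n := fun m n hmn => by
    simp only [breatherFreq, CharP.cast_eq_zero, mul_zero, zero_add, one_mul, hΩ, hN]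
    have : (m : ℝ) < n := Nat.cast_lt.2 hmn
    push_cast
    gcongr
  refine ⟨fun M => modeSeries a b c (breatherFreq (Ω M)) (breatherCoeff U a b γ (Ω M)),
    fun M => ⟨hW M, (hS M).not_ae_zero (hα M), ?_⟩, fun m n hmn τ hae => ?_⟩
  · have h0 : 0 < ∑' n, |breatherCoeff U a b γ (Ω M) n| :=
      (hS M).summable.tsum_pos (fun _ => abs_nonneg _) 0 (abs_pos.2 (hα M))
    exact ⟨_, _, mul_pos h0 profConst_pos, decay_pos ha (hΩ0 M),
      fun x t => (hS M).abs_modeSeries_le (x, t)⟩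
  · rcases lt_or_gt_of_ne hmn with hl | hl
    · exact (hS m).not_ae_eq (hS n) (hα m) (hlt m n hl) τ 0 (by simpa only [add_zero] using hae)
    · exact (hS n).not_ae_eq (hS m) (hα n) (hlt n m hl) 0 τ (by simpa only [add_zero] using hae.symm)
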